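/- Work in second-order arithmetic: $\mathsf{RCA}_0$ consists of the axioms of discrete ordered semirings, $\Sigma^0_1$-induction and $\Delta^0_1$-comprehension, and $\mathsf{ACA}_0$ adds arithmetical comprehension. Finite sequences of numbers, and functions on numbers, are coded in the usual way, and $(Z)_i=\{m\mid \langle m,i\rangle\in Z\}$. For a number $n$, a formula $\psi(y,f)$ in $\Sigma^0_1$ (number and set parameters allowed, $f$ ranging over $\mathbb N^{\mathbb N}$) \emph{presents} a $(\Sigma^0_1)_n$ set if $\psi(n,f)$ always holds and $\psi(z,f)$ implies $\psi(y,f)$ whenever $z<y<n$; the presented set consists of those $f$ for which the least $y\le n$ with $y=n\lor\psi(y,f)$ is even. The axiom $\forall n.(\Sigma^0_1)_n\text{-}\mathsf{Det}$ says that for each $\Sigma^0_1$ formula $\psi$ and each number $n$ such that $\psi$ presents a $(\Sigma^0_1)_n$ set $A$, the Gale--Stewart game on $\mathbb N$ with payoff $A$ is determined: either there is a strategy $\sigma$ of player $\mathsf I$ such that $\sigma\otimes\tau\in A$ for all strategies $\tau$ of player $\mathsf{II}$, or there is a strategy $\tau$ of player $\mathsf{II}$ such that $\sigma\otimes\tau\notin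 A$ for all strategies $\sigma$ of player $\mathsf I$. Here $\sigma\otimes\tau$ is the resulting play. A set $W$ codes the $\omega$-model whose sets are the $(W)_i$, $i\in\mathbb N$; we write $X\in W$ if $X=(W)_i$ for some $i$. $W$ is a \emph{coded $\beta$-model} if each $\Sigma^1_1$ formula with parameters in the model coded by $W$ is true in that model if and only if it is true. For coded models, $W\subseteq_\beta W'$ means that every set in $W$ is in $W'$ and that each $\Sigma^1_1$ formula with parameters in $W$ is true in the model coded by $W$ if and only if it is true in the model coded by $W'$. $\Pi^1_1\text{-}\mathsf{CA}_0'$ is $\mathsf{RCA}_0$ together with the axiom: for all numbers $n$ and sets $X$ there is a sequence $\langle X_0,\dots,X_n\rangle$ (coded by a single set) of coded $\beta$-models such that $X\in X_0$ and, for all $i<n$, $X_i\in X_{i+1}$ and $X_i\subseteq_\beta X_{i+1}$. \textbf{Proposition.} Over $\mathsf{ACA}_0$, $\forall n.(\Sigma^0_1)_n\text{-}\mathsf{Det}$ implies $\Pi^1_1\text{-}\mathsf{CA}_0'$. That is, every model (possibly with nonstandard numbers, and with set quantifiers ranging over any nonempty collection of sets of its numbers) of $\mathsf{ACA}_0$ and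 $\forall n.(\Sigma^0_1)_n\text{-}\mathsf{Det}$ is a model of $\Pi^1_1\text{-}\mathsf{CA}_0'$. -/

import Mathlib

universe u

namespace SOA

/-! ### The language of second-order arithmetic

Number variables and set variables are both named by natural numbers. -/

/-- Numerical terms. -/
inductive Term : Type
  | var (x : ℕ) : Term
  | zero : Term
  | one : Term
  | add (s t : Term) : Term
  | mul (s t : Term) : Term

/-- The number variable `x` occurs in a term. -/
def Term.Occurs (x : ℕ) : Term → Prop
  | .var y => x = y
  | .zero => False
  | .one => False
  | .add s t => s.Occurs x ∨ t.Occurs x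
  | .mul s t => s.Occurs x ∨ t.Occurs x

/-- Formulas of second-order arithmetic: `mem t X` is `t ∈ X`; `allN x`, `exN x` quantify the
number variable `x`; `allS X`, `exS X` quantify the set variable `X`. -/
inductive Formula : Type
  | eq (s t : Term) : Formula
  | lt (s t : Term) : Formula
  | mem (t : Term) (X : ℕ) : Formula
  | not (φ : Formula) : Formula
  | and (φ ψ : Formula) : Formula
  | or (φ ψ : Formula) : Formula
  | imp (φ ψ : Formula) : Formula
  | allN (x : ℕ) (φ : Formula) : Formula
  | exN (x : ℕ) (φ : Formula) : Formula
  | allS (X : ℕ) (φ : Formula) : Formula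
  | exS (X : ℕ) (φ : Formula) : Formula

/-- `Σ⁰₀` formulas: all quantifiers are bounded number quantifiers `∀ x < t`, `∃ x < t`, where `x`
does not occur in `t`. -/
inductive IsSigma00 : Formula → Prop
  | eq (s t : Term) : IsSigma00 (.eq s t)
  | lt (s t : Term) : IsSigma00 (.lt s t)
  | mem (t : Term) (X : ℕ) : IsSigma00 (.mem t X)
  | not {φ : Formula} : IsSigma00 φ → IsSigma00 (.not φ)
  | and {φ ψ : Formula} : IsSigma00 φ → IsSigma00 ψ → IsSigma00 (.and φ ψ)
  | or {φ ψ : Formula} : IsSigma00 φ → IsSigma00 ψ → IsSigma00 (.or φ ψ)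
  | imp {φ ψ : Formula} : IsSigma00 φ → IsSigma00 ψ → IsSigma00 (.imp φ ψ)
  | ballN {x : ℕ} {t : Term} {φ : Formula} : ¬ t.Occurs x → IsSigma00 φ →
      IsSigma00 (.allN x (.imp (.lt (.var x) t) φ))
  | bexN {x : ℕ} {t : Term} {φ : Formula} : ¬ t.Occurs x → IsSigma00 φ →
      IsSigma00 (.exN x (.and (.lt (.var x) t) φ))

/-- `Σ⁰₁` formulas `∃ x θ`, with `θ` a `Σ⁰₀` formula. -/
def IsSigma01 (φ : Formula) : Prop := ∃ (x : ℕ) (θ : Formula), IsSigma00 θ ∧ φ = .exN x θ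

/-- `Π⁰₁` formulas `∀ x θ`, with `θ` a `Σ⁰₀` formula. -/
def IsPi01 (φ : Formula) : Prop := ∃ (x : ℕ) (θ : Formula), IsSigma00 θ ∧ φ = .allN x θ

/-- Arithmetical formulas: no set quantifiers (set parameters are allowed). -/
def IsArithmetical : Formula → Prop
  | .eq _ _ => True
  | .lt _ _ => True
  | .mem _ _ => True
  | .not φ => IsArithmetical φ
  | .and φ ψ => IsArithmetical φ ∧ IsArithmetical ψ
  | .or φ ψ => IsArithmetical φ ∧ IsArithmetical ψ
  | .imp φ ψ => IsArithmetical φ ∧ IsArithmetical ψ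
  | .allN _ φ => IsArithmetical φ
  | .exN _ φ => IsArithmetical φ
  | .allS _ _ => False
  | .exS _ _ => False

/-- `Σ¹₁` formulas `∃ X θ`, with `θ` arithmetical. -/
def IsSigma11 (φ : Formula) : Prop := ∃ (X : ℕ) (θ : Formula), IsArithmetical θ ∧ φ = .exS X θ

/-! ### Structures and satisfaction -/

/-- The non-logical symbols of first-order arithmetic, interpreted on a type. -/
class Arith (N : Type u) extends Zero N, One N, Add N, Mul N, LT N

/-- A (Henkin) structure for second-order arithmetic: a possibly nonstandard first-order part `N`,
and a nonempty collection of subsets of `N` over which the set quantifiers range. -/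
structure L2Structure where
  N : Type u
  arith : Arith N
  sets : Set (Set N)
  sets_nonempty : sets.Nonempty

attribute [instance] L2Structure.arith

/-- Value of a term. -/
def Term.eval {N : Type u} [Arith N] (v : ℕ → N) : Term → N
  | .var x => v x
  | .zero => 0
  | .one => 1
  | .add s t => s.eval v + t.eval v
  | .mul s t => s.eval v * t.eval v

/-- Satisfaction of a formula in a structure, under an assignment `v` of numbers to the number
variables and `V` of sets to the set variables. -/
def L2Structure.Sat (M : L2Structure.{u}) : Formula → (ℕ → M.N) → (ℕ → Set M.N) → Prop
  | .eq s t, v, _ => s.eval v = t.eval v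
  | .lt s t, v, _ => s.eval v < t.eval v
  | .mem t X, v, V => t.eval v ∈ V X
  | .not φ, v, V => ¬ M.Sat φ v V
  | .and φ ψ, v, V => M.Sat φ v V ∧ M.Sat ψ v V
  | .or φ ψ, v, V => M.Sat φ v V ∨ M.Sat ψ v V
  | .imp φ ψ, v, V => M.Sat φ v V → M.Sat ψ v V
  | .allN x φ, v, V => ∀ a : M.N, M.Sat φ (Function.update v x a) V
  | .exN x φ, v, V => ∃ a : M.N, M.Sat φ (Function.update v x a) V
  | .allS X φ, v, V => ∀ A ∈ M.sets, M.Sat φ v (Function.update V X A)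
  | .exS X φ, v, V => ∃ A ∈ M.sets, M.Sat φ v (Function.update V X A)

/-- All values of a set assignment are sets of the structure (admissible set parameters). -/
def L2Structure.IsAssignment (M : L2Structure.{u}) (V : ℕ → Set M.N) : Prop :=
  ∀ k, V k ∈ M.sets

/-! ### The systems `RCA₀` and `ACA₀` -/

/-- The axioms for discrete ordered semirings (nonnegative parts of discretely ordered rings). -/
structure IsDiscreteOrderedSemiring (N : Type u) [Arith N] : Prop where
  add_assoc : ∀ x y z : N, (x + y) + z = x + (y + z)
  add_comm : ∀ x y : N, x + y = y + x
  mul_assoc : ∀ x y z : N, (x * y) * z = x * (y * z)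
  mul_comm : ∀ x y : N, x * y = y * x
  mul_add : ∀ x y z : N, x * (y + z) = x * y + x * z
  add_zero : ∀ x : N, x + 0 = x
  mul_zero : ∀ x : N, x * 0 = 0
  mul_one : ∀ x : N, x * 1 = x
  lt_trans : ∀ x y z : N, x < y → y < z → x < z
  lt_irrefl : ∀ x : N, ¬ x < x
  lt_trichotomy : ∀ x y : N, x < y ∨ x = y ∨ y < x
  add_lt_add : ∀ x y z : N, x < y → x + z < y + z
  mul_lt_mul : ∀ x y z : N, 0 < z → x < y → x * z < y * z
  exists_add : ∀ x y : N, x < y → ∃ z, x + z = y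
  zero_lt_one : (0 : N) < 1
  discrete : ∀ x : N, 0 < x → 1 < x ∨ 1 = x
  nonneg : ∀ x : N, 0 < x ∨ 0 = x

/-- The scheme of `Σ⁰₁`-induction (with number and set parameters). -/
def Sigma01Induction (M : L2Structure.{u}) : Prop :=
  ∀ φ : Formula, IsSigma01 φ → ∀ (x : ℕ) (v : ℕ → M.N) (V : ℕ → Set M.N), M.IsAssignment V →
    M.Sat φ (Function.update v x 0) V →
    (∀ a : M.N, M.Sat φ (Function.update v x a) V → M.Sat φ (Function.update v x (a + 1)) V) →
    ∀ a : M.N, M.Sat φ (Function.update v x a) V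

/-- The scheme of `Δ⁰₁`-comprehension (with number and set parameters). -/
def Delta01Comprehension (M : L2Structure.{u}) : Prop :=
  ∀ φ ψ : Formula, IsSigma01 φ → IsPi01 ψ →
    ∀ (x : ℕ) (v : ℕ → M.N) (V : ℕ → Set M.N), M.IsAssignment V →
    (∀ a : M.N, M.Sat φ (Function.update v x a) V ↔ M.Sat ψ (Function.update v x a) V) →
    ∃ A ∈ M.sets, ∀ a : M.N, a ∈ A ↔ M.Sat φ (Function.update v x a) V

/-- The scheme of arithmetical comprehension (with number and set parameters). -/
def ArithmeticalComprehension (M : L2Structure.{u}) : Prop :=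
  ∀ φ : Formula, IsArithmetical φ →
    ∀ (x : ℕ) (v : ℕ → M.N) (V : ℕ → Set M.N), M.IsAssignment V →
    ∃ A ∈ M.sets, ∀ a : M.N, a ∈ A ↔ M.Sat φ (Function.update v x a) V

/-- `M` is a model of `RCA₀`. -/
structure RCA0 (M : L2Structure.{u}) : Prop where
  semiring : IsDiscreteOrderedSemiring M.N
  induction : Sigma01Induction M
  comprehension : Delta01Comprehension M

/-- `M` is a model of `ACA₀`. -/
structure ACA0 (M : L2Structure.{u}) : Prop where
  rca0 : RCA0 M
  comprehension : ArithmeticalComprehension M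

/-! ### Coding of pairs, functions and finite sequences -/

section Coding

variable {N : Type u} [Arith N]

/-- The pairing `(i, j) = (i + j)² + i`. -/
def pair (i j : N) : N := (i + j) * (i + j) + i

/-- The `i`-th column `(Z)_i = {m | (m, i) ∈ Z}`. -/
def column (Z : Set N) (i : N) : Set N := {m | pair m i ∈ Z}

/-- `f` is (the graph of) a function from numbers to numbers. -/
def IsFunction (f : Set N) : Prop :=
  (∀ p ∈ f, ∃ i j, p = pair i j) ∧ ∀ i, ∃! j, pair i j ∈ f

/-- `p` belongs to the finite set coded by `s = (k, (m, n))`, that is, `p < k` and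
`m (p + 1) + 1` divides `n`. Numbers that are not of this form code the empty set. -/
def InFinite (s p : N) : Prop :=
  ∃ k m n, s = pair k (pair m n) ∧ p < k ∧ ∃ q, n = (m * (p + 1) + 1) * q

/-- The finite set coded by `s` is `{(i, f i) | i < l}`. -/
def CodesInitial (f : Set N) (l s : N) : Prop :=
  ∀ p, InFinite s p ↔ ∃ i j, i < l ∧ pair i j ∈ f ∧ p = pair i j

/-- `s` is the code of the finite sequence `⟨f 0, …, f (l - 1)⟩`: the least number coding its
graph. -/
def IsInitialCode (f : Set N) (l s : N) : Prop :=
  CodesInitial f l s ∧ ∀ s', s' < s → ¬ CodesInitial f l s'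

/-- Evenness. -/
def IsEven (k : N) : Prop := ∃ j, k = j + j

/-- `f` is the play `σ ⊗ τ` in which player I uses `σ` and player II uses `τ`: a strategy is a
function on codes of finite sequences, and `f k` is the value at the code of `⟨f 0, …, f (k - 1)⟩`
of `σ` if `k` is even and of `τ` if `k` is odd. -/
def IsPlay (σ τ f : Set N) : Prop :=
  ∀ k s a, IsInitialCode f k s → pair k a ∈ f →
    (IsEven k → pair s a ∈ σ) ∧ (¬ IsEven k → pair s a ∈ τ)

end Coding

/-! ### Determinacy of finite differences of open sets in Baire space -/

/-- `f` is an element of the Baire space of `M`; also used for strategies. -/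
def IsPoint (M : L2Structure.{u}) (f : Set M.N) : Prop := f ∈ M.sets ∧ IsFunction f

/-- The Gale–Stewart game on numbers with payoff `A` for player I is determined in `M`. -/
def Determined (M : L2Structure.{u}) (A : Set M.N → Prop) : Prop :=
  (∃ σ, IsPoint M σ ∧ ∀ τ, IsPoint M τ → ∀ f, IsPoint M f → IsPlay σ τ f → A f) ∨
  (∃ τ, IsPoint M τ ∧ ∀ σ, IsPoint M σ → ∀ f, IsPoint M f → IsPlay σ τ f → ¬ A f)

/-- `P y f` presents a difference of length `n`: `P n f` always holds, and `P z f` implies `P y f`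
for `z < y < n`. -/
def IsPresentation (M : L2Structure.{u}) (n : M.N) (P : M.N → Set M.N → Prop) : Prop :=
  ∀ f, IsPoint M f → P n f ∧ ∀ z y, z < y → y < n → P z f → P y f

/-- The payoff presented by `P`: the least `y ≤ n` such that `y = n` or `P y f` is even. -/
def differencePayoff {N : Type u} [Arith N] (n : N) (P : N → Set N → Prop) (f : Set N) : Prop :=
  ∃ y, (y < n ∨ y = n) ∧ (y = n ∨ P y f) ∧ (∀ z, z < y → ¬ (z = n ∨ P z f)) ∧ IsEven y

/-- `∀ n. (Σ⁰₁)_n-Det`: for each `Σ⁰₁` formula `ψ(y, f)` with number and set parameters and each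
number `n` of `M`, if `ψ` presents a difference of length `n`, then the game it presents is
determined. -/
def AllSigma01DiffDet (M : L2Structure.{u}) : Prop :=
  ∀ ψ : Formula, IsSigma01 ψ →
    ∀ (y F : ℕ) (v : ℕ → M.N) (V : ℕ → Set M.N), M.IsAssignment V → ∀ n : M.N,
      IsPresentation M n
        (fun a f => M.Sat ψ (Function.update v y a) (Function.update V F f)) →
      Determined M (differencePayoff n
        (fun a f => M.Sat ψ (Function.update v y a) (Function.update V F f)))

/-! ### Coded `β`-models and `Π¹₁-CA₀′` -/

/-- The coded `ω`-model given by `W`: same numbers, and the sets are the columns of `W`. -/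
def coded (M : L2Structure.{u}) (W : Set M.N) : L2Structure.{u} where
  N := M.N
  arith := M.arith
  sets := {A | ∃ i, A = column W i}
  sets_nonempty := ⟨column W 0, 0, rfl⟩

/-- `W` codes a `β`-model: each `Σ¹₁` formula with parameters in the coded model holds in it iff it
holds in the ground model `M`. -/
def IsCodedBetaModel (M : L2Structure.{u}) (W : Set M.N) : Prop :=
  ∀ φ : Formula, IsSigma11 φ → ∀ (v : ℕ → M.N) (V : ℕ → Set M.N),
    (coded M W).IsAssignment V → ((coded M W).Sat φ v V ↔ M.Sat φ v V)

/-- The model coded by `W` is a `β`-submodel of the one coded by `W'`: every set of the first is a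
set of the second, and both satisfy the same `Σ¹₁` formulas with parameters in the first. -/
def IsBetaSubmodel (M : L2Structure.{u}) (W W' : Set M.N) : Prop :=
  (coded M W).sets ⊆ (coded M W').sets ∧
  ∀ φ : Formula, IsSigma11 φ → ∀ (v : ℕ → M.N) (V : ℕ → Set M.N),
    (coded M W).IsAssignment V → ((coded M W).Sat φ v V ↔ (coded M W').Sat φ v V)

/-- `Z` codes a sequence `⟨(Z)_0, …, (Z)_n⟩` of coded `β`-models with `X ∈ (Z)_0`, and
`(Z)_i ∈ (Z)_{i+1}` and `(Z)_i ⊆_β (Z)_{i+1}` for `i < n`. -/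
structure IsBetaChain (M : L2Structure.{u}) (n : M.N) (X Z : Set M.N) : Prop where
  beta : ∀ i, (i < n ∨ i = n) → IsCodedBetaModel M (column Z i)
  base : X ∈ (coded M (column Z 0)).sets
  mem : ∀ i, i < n → column Z i ∈ (coded M (column Z (i + 1))).sets
  sub : ∀ i, i < n → IsBetaSubmodel M (column Z i) (column Z (i + 1))

/-- `M` is a model of `Π¹₁-CA₀′`: `RCA₀`, and for all numbers `n` and sets `X` of `M` there is a
chain as above. -/
structure Pi11CA0' (M : L2Structure.{u}) : Prop where
  rca0 : RCA0 M
  chain : ∀ n : M.N, ∀ X ∈ M.sets, ∃ Z ∈ M.sets, IsBetaChain M n X Z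

end SOA

/-!
Models of second-order arithmetic are handled semantically. A model of `ACA₀` is a discretely
ordered semiring `N` with a collection `S` of sets satisfying `IsACA`, and `IsDef S f` says that the
graph of `f` is in `S`. The class of definable maps is closed under the connectives, number
quantifiers, least witnesses, finite coding and primitive recursion, so `fun_prop` proves most
instances of comprehension.

*A jump hierarchy from determinacy.* For a closed condition on functions (`Obeys C`) and a set `H`,
let the jump of `H` be the set of finite sequences that extend to a function meeting the condition
with `H` as its zeroth column (a path over `H`). Let `n` be a number of the model, possibly
nonstandard. Induction on `j ≤ n` cannot be used to form the `j`-th jump `H j` of a set `A`, since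
the statement is not arithmetical; all jumps are obtained at once from a winning strategy of a
single game. Player I asks whether `y ∈ H (j + 1)`, and player II says yes or no. Whoever holds the
positive claim names the values of a path over `H j` that extends `y`; the opponent may at any time
challenge a named value in the zeroth column, which is a claim, positive or negative, about `H j`,
and the play goes on one level below. The winner is determined by the parity of the least `rank`
met, so the payoff is a finite difference of open sets (`exists_winning_strategy`). In plays of a
winning strategy, the same claim is never made by both players (`Wins.consistent`): otherwise the
strategy could be continued against itself from the two positions, with the same moves and with the
roles of the players exchanged, and would both win and lose. Hence player I has no winning strategy
(`Wins.not_one`), and the answers given by a winning strategy of player II form the hierarchy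
(`exists_jump_hierarchy`).

*A `β`-model from a leftmost path.* The closed condition `progCond` has as its paths the functions
whose columns satisfy all accepted programs; a program is a finite system of equations, defining new
columns from old ones and possibly asserting that a value is not zero. The leftmost path over a set
is computed from the jump of the set (`exists_isLeftmost`, `IsLeftmost.spec`). It accepts every
program with a solution, since accepting it (the value `0`) and rejecting all later programs gives a
path that lies to the left of one that rejects it (`holds_of_solution`). Truth of an arithmetical
formula in given sets can be asserted by a program (`compilesRel_formula`), so the columns of the
leftmost path contain witnesses for all true `Σ¹₁` formulas about them, that is, they form a
`β`-model (`isBeta_columns`).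

*The chain.* The leftmost paths over `H 0, …, H n` give the chain. The path over `H j` is
arithmetical in `H (j + 1)`, the zeroth column of the next path, and every `β`-model is closed under
arithmetical comprehension, so each model is a member of the next (`exists_beta_chain`).
-/

namespace SOA

/-! ### Discrete ordered semirings -/

/-- A discretely ordered commutative semiring, with Mathlib's algebraic and order structure. -/
class DOSemiring (N : Type u) extends CommSemiring N, LinearOrder N, IsStrictOrderedRing N,
    CanonicallyOrderedAdd N where
  one_le_of_pos : ∀ x : N, 0 < x → 1 ≤ x

/-- The arithmetical symbols of a `DOSemiring`. -/
abbrev DOSemiring.arith (N : Type u) [DOSemiring N] : Arith N where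
  toZero := inferInstance
  toOne := inferInstance
  toAdd := inferInstance
  toMul := inferInstance
  toLT := inferInstance

open Classical in
/-- The Mathlib structure on a model of the axioms of discrete ordered semirings. -/
noncomputable abbrev IsDiscreteOrderedSemiring.toDOSemiring {N : Type u} [Arith N]
    (h : IsDiscreteOrderedSemiring N) : DOSemiring N where
  add_assoc := h.add_assoc
  add_comm := h.add_comm
  zero_add x := by rw [h.add_comm, h.add_zero]
  add_zero := h.add_zero
  mul_assoc := h.mul_assoc
  mul_comm := h.mul_comm
  one_mul x := by rw [h.mul_comm, h.mul_one]
  mul_one := h.mul_one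
  zero_mul x := by rw [h.mul_comm, h.mul_zero]
  mul_zero := h.mul_zero
  left_distrib := h.mul_add
  right_distrib x y z := by rw [h.mul_comm, h.mul_add, h.mul_comm z x, h.mul_comm z y]
  nsmul := nsmulRec
  le x y := x < y ∨ x = y
  le_refl x := Or.inr rfl
  le_trans x y z := by
    rintro (a | rfl) (b | rfl)
    · exact Or.inl (h.lt_trans _ _ _ a b)
    · exact Or.inl a
    · exact Or.inl b
    · exact Or.inr rfl
  lt_iff_le_not_ge x y := by
    constructor
    · intro a
      refine ⟨Or.inl a, ?_⟩
      rintro (b | rfl)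
      · exact h.lt_irrefl _ (h.lt_trans _ _ _ a b)
      · exact h.lt_irrefl _ a
    · rintro ⟨a | rfl, b⟩
      · exact a
      · exact absurd (Or.inr rfl) b
  le_antisymm x y := by
    rintro (a | rfl) (b | b)
    · exact absurd (h.lt_trans _ _ _ a b) (h.lt_irrefl _)
    · exact b.symm
    · rfl
    · rfl
  le_total x y := by
    rcases h.lt_trichotomy x y with a | a | a
    · exact Or.inl (Or.inl a)
    · exact Or.inl (Or.inr a)
    · exact Or.inr (Or.inl a)
  toDecidableLE := Classical.decRel _
  add_le_add_left x y a z := by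
    rcases a with a | rfl
    · exact Or.inl (h.add_lt_add _ _ _ a)
    · exact Or.inr rfl
  le_of_add_le_add_left x y z a := by
    rcases h.lt_trichotomy y z with b | b | b
    · exact Or.inl b
    · exact Or.inr b
    · exfalso
      have c := h.add_lt_add _ _ x b
      rw [h.add_comm z, h.add_comm y] at c
      rcases a with a | a
      · exact h.lt_irrefl _ (h.lt_trans _ _ _ a c)
      · change x + y = x + z at a
        rw [a] at c
        exact h.lt_irrefl _ c
  zero_le_one := Or.inl h.zero_lt_one
  exists_pair_ne := ⟨0, 1, fun e => h.lt_irrefl 0 (by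
    have := h.zero_lt_one
    rwa [← e] at this)⟩
  mul_lt_mul_of_pos_left x hx y z hyz := by
    have := h.mul_lt_mul y z x hx hyz
    change x * y < x * z
    rwa [h.mul_comm y, h.mul_comm z] at this
  mul_lt_mul_of_pos_right x hx y z hyz := h.mul_lt_mul y z x hx hyz
  exists_add_of_le {x y} a := by
    rcases a with a | rfl
    · obtain ⟨z, hz⟩ := h.exists_add _ _ a
      exact ⟨z, hz.symm⟩
    · exact ⟨0, (h.add_zero _).symm⟩
  le_self_add x y := by
    rcases h.nonneg y with a | a
    · have := h.add_lt_add _ _ x a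
      rw [h.add_comm 0, h.add_zero, h.add_comm y] at this
      exact Or.inl this
    · right
      rw [← a]
      exact (h.add_zero _).symm
  le_add_self x y := by
    rcases h.nonneg y with a | a
    · have := h.add_lt_add _ _ x a
      rw [h.add_comm 0, h.add_zero] at this
      exact Or.inl this
    · right
      rw [← a]
      exact (h.add_zero _).symm.trans (h.add_comm _ _)
  one_le_of_pos x hx := h.discrete x hx

section
variable {N : Type u} [DOSemiring N]

theorem lt_succ_iff {a b : N} : a < b + 1 ↔ a ≤ b := by
  constructor
  · intro h
    by_contra hc
    push Not at hc
    obtain ⟨c, rfl⟩ := exists_add_of_le hc.le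
    have hc0 : 0 < c := by
      rcases (zero_le (a := c)).eq_or_lt with e | e
      · simp [← e] at hc
      · exact e
    have := DOSemiring.one_le_of_pos c hc0
    have := add_le_add_right this b
    exact absurd h (not_lt.mpr this)
  · intro h
    exact lt_of_le_of_lt h (lt_add_one b)

theorem zero_lt_succ (a : N) : 0 < a + 1 := lt_succ_iff.mpr zero_le

theorem succ_le_iff' {a b : N} : a + 1 ≤ b ↔ a < b := by
  rw [← lt_succ_iff, add_lt_add_iff_right]

theorem eq_zero_or_succ (a : N) : a = 0 ∨ ∃ b, a = b + 1 := by
  rcases (zero_le (a := a)).eq_or_lt with e | e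
  · exact Or.inl e.symm
  · right
    obtain ⟨c, hc⟩ := exists_add_of_le (DOSemiring.one_le_of_pos a e)
    exact ⟨c, by rw [hc, add_comm]⟩

/-- The pairing `(i + j)² + i`. -/
def pr (i j : N) : N := (i + j) * (i + j) + i

theorem pr_inj {a b c d : N} (h : pr a b = pr c d) : a = c ∧ b = d := by
  unfold pr at h
  have key : ∀ {a b c d : N}, (a + b) * (a + b) + a = (c + d) * (c + d) + c → ¬ a + b < c + d := by
    intro a b c d h hlt
    obtain ⟨e, he⟩ := exists_add_of_le (succ_le_iff'.mpr hlt)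
    have h1 : (c + d) * (c + d) + c =
        (a + b) * (a + b) + a + (a + b + b + 1 + e * e + (1 + 1) * e * (a + b + 1) + c) := by
      rw [he]; ring
    rw [← h] at h1
    have h2 := (left_eq_add (a := (a + b) * (a + b) + a)).mp h1
    have : (0 : N) < a + b + b + 1 + e * e + (1 + 1) * e * (a + b + 1) + c := by positivity
    exact this.ne' h2
  have e : a + b = c + d := le_antisymm (not_lt.mp (key h.symm)) (not_lt.mp (key h))
  rw [e] at h
  have e1 : a = c := add_left_cancel h
  subst e1
  exact ⟨rfl, add_left_cancel e⟩

@[simp] theorem pr_eq_iff {a b c d : N} : pr a b = pr c d ↔ a = c ∧ b = d :=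
  ⟨pr_inj, by rintro ⟨rfl, rfl⟩; rfl⟩

theorem le_self_mul_self (a : N) : a ≤ a * a := by
  rcases eq_zero_or_succ a with rfl | ⟨b, rfl⟩
  · simp
  · calc b + 1 = (b + 1) * 1 := by ring
      _ ≤ (b + 1) * (b + 1) := by gcongr; simp

theorem left_le_pr (a b : N) : a ≤ pr a b := le_add_self

theorem right_le_pr (a b : N) : b ≤ pr a b :=
  le_trans (le_trans le_add_self (le_self_mul_self _)) le_self_add

/-- `p` belongs to the finite set coded by `s`. -/
def InF (s p : N) : Prop :=
  ∃ k m n, s = pr k (pr m n) ∧ p < k ∧ ∃ q, n = (m * (p + 1) + 1) * q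

theorem InF.lt {s p : N} (h : InF s p) : p < s := by
  obtain ⟨k, m, n, rfl, h, -⟩ := h
  exact lt_of_lt_of_le h (left_le_pr _ _)

/-- The structure of second-order arithmetic with numbers `N` and sets `S`. -/
abbrev toL2 (S : Set (Set N)) (hS : S.Nonempty) : L2Structure where
  N := N
  arith := DOSemiring.arith N
  sets := S
  sets_nonempty := hS

/-- Value of a term in a `DOSemiring`. -/
def tv (t : Term) (v : ℕ → N) : N := @Term.eval N (DOSemiring.arith N) v t

@[simp] theorem tv_var (v : ℕ → N) (x) : tv (.var x) v = v x := rfl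
@[simp] theorem tv_zero (v : ℕ → N) : tv .zero v = 0 := rfl
@[simp] theorem tv_one (v : ℕ → N) : tv .one v = 1 := rfl
@[simp] theorem tv_add (v : ℕ → N) (s t) : tv (.add s t) v = tv s v + tv t v := rfl
@[simp] theorem tv_mul (v : ℕ → N) (s t) : tv (.mul s t) v = tv s v * tv t v := rfl

/-- Satisfaction of formulas without set quantifiers; it does not depend on the collection of
sets, and formulas with set quantifiers are given a dummy value. -/
def ASat : Formula → (ℕ → N) → (ℕ → Set N) → Prop
  | .eq s t, v, _ => tv s v = tv t v
  | .lt s t, v, _ => tv s v < tv t v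
  | .mem t X, v, V => tv t v ∈ V X
  | .not φ, v, V => ¬ ASat φ v V
  | .and φ ψ, v, V => ASat φ v V ∧ ASat ψ v V
  | .or φ ψ, v, V => ASat φ v V ∨ ASat ψ v V
  | .imp φ ψ, v, V => ASat φ v V → ASat ψ v V
  | .allN x φ, v, V => ∀ a : N, ASat φ (Function.update v x a) V
  | .exN x φ, v, V => ∃ a : N, ASat φ (Function.update v x a) V
  | .allS _ _, _, _ => True
  | .exS _ _, _, _ => True

theorem sat_iff_aSat (S : Set (Set N)) (hS : S.Nonempty) (φ : Formula) (hφ : IsArithmetical φ)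
    (v : ℕ → N) (V : ℕ → Set N) : (toL2 S hS).Sat φ v V ↔ ASat φ v V := by
  induction φ generalizing v with
  | eq | lt | mem => exact Iff.rfl
  | not φ ih => exact not_congr (ih hφ v)
  | and φ ψ ih1 ih2 => exact and_congr (ih1 hφ.1 v) (ih2 hφ.2 v)
  | or φ ψ ih1 ih2 => exact or_congr (ih1 hφ.1 v) (ih2 hφ.2 v)
  | imp φ ψ ih1 ih2 => exact imp_congr (ih1 hφ.1 v) (ih2 hφ.2 v)
  | allN x φ ih => exact forall_congr' fun a => ih hφ _
  | exN x φ ih => exact exists_congr fun a => ih hφ _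
  | allS => exact hφ.elim
  | exS => exact hφ.elim

/-- `S` is the collection of sets of a model of arithmetical comprehension and induction. -/
class IsACA (S : Set (Set N)) : Prop where
  nonempty : S.Nonempty
  comprehension : ∀ φ : Formula, IsArithmetical φ → ∀ (x : ℕ) (v : ℕ → N) (V : ℕ → Set N),
    (∀ k, V k ∈ S) → {a | ASat φ (Function.update v x a) V} ∈ S
  induction : ∀ A ∈ S, (0 : N) ∈ A → (∀ a ∈ A, a + 1 ∈ A) → ∀ a, a ∈ A

end

/-! ### Definable maps -/

section
variable {N : Type u} [DOSemiring N]

/-- A type whose elements are coded by numbers, the set of codes being in `S`. -/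
class Coded (S : Set (Set N)) (Γ : Type*) where
  enc : Γ → N
  enc_injective : Function.Injective enc
  range_mem : Set.range enc ∈ S

/-- The term `pr s t`. -/
def prT (s t : Term) : Term := .add (.mul (.add s t) (.add s t)) s

@[simp] theorem tv_prT (s t : Term) (v : ℕ → N) : tv (prT s t) v = pr (tv s v) (tv t v) := rfl

variable {S : Set (Set N)} [IsACA S]

/-- Comprehension for a formula with at most two set parameters and a number parameter (the value
of all variables but the one comprehended over). -/
theorem comprehension₂ (φ : Formula) (hφ : IsArithmetical φ) {A B : Set N} (hA : A ∈ S) (hB : B ∈ S)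
    (c : N) :
    {a | ASat φ (Function.update (fun _ => c) 0 a) (fun k => if k = 0 then A else B)} ∈ S :=
  IsACA.comprehension φ hφ 0 _ _ fun k => by split_ifs <;> assumption

theorem univ_mem : (Set.univ : Set N) ∈ S := by
  obtain ⟨A, hA⟩ := IsACA.nonempty (S := S)
  have := comprehension₂ (.eq .zero .zero) trivial hA hA (0 : N)
  convert this using 1
  ext; simp [ASat]

instance : Coded S N where
  enc := id
  enc_injective := Function.injective_id
  range_mem := by rw [Set.range_id]; exact univ_mem

open Classical in
noncomputable instance : Coded S Prop where
  enc P := if P then 1 else 0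
  enc_injective P Q h := by
    by_cases hP : P <;> by_cases hQ : Q <;> simp_all
  range_mem := by
    have := comprehension₂ (.or (.eq (.var 0) .zero) (.eq (.var 0) .one)) ⟨trivial, trivial⟩
      (univ_mem (S := S)) univ_mem (0 : N)
    convert this using 1
    ext a
    simp only [Set.mem_range, ASat, tv_var, Function.update_self, tv_zero, tv_one,
      Set.mem_ofPred_eq]
    constructor
    · rintro ⟨P, rfl⟩; split_ifs <;> simp
    · rintro (rfl | rfl)
      · exact ⟨False, by simp⟩
      · exact ⟨True, by simp⟩

variable {Γ Δ Θ : Type*} [Coded S Γ] [Coded S Δ] [Coded S Θ]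

instance : Coded S (Γ × Δ) where
  enc p := pr (Coded.enc S p.1) (Coded.enc S p.2)
  enc_injective p q h := by
    obtain ⟨h1, h2⟩ := pr_inj h
    exact Prod.ext (Coded.enc_injective h1) (Coded.enc_injective h2)
  range_mem := by
    have := comprehension₂ (.exN 1 (.exN 2 (.and (.eq (.var 0) (prT (.var 1) (.var 2)))
      (.and (.mem (.var 1) 0) (.mem (.var 2) 1))))) ⟨trivial, trivial, trivial⟩
      (Coded.range_mem (S := S) (Γ := Γ)) (Coded.range_mem (S := S) (Γ := Δ)) (0 : N)
    convert this using 1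
    ext a
    simp only [Set.mem_range, ASat, tv_var, tv_prT, Set.mem_ofPred_eq]
    simp only [Prod.exists]
    constructor
    · rintro ⟨x, y, rfl⟩; exact ⟨_, _, by simp; exact ⟨rfl, rfl⟩, by simp, by simp⟩
    · rintro ⟨x, y, h1, h2, h3⟩
      simp at h1 h2 h3
      obtain ⟨x, rfl⟩ := h2
      obtain ⟨y, rfl⟩ := h3
      exact ⟨x, y, h1.symm⟩

@[simp] theorem enc_prod (x : Γ) (y : Δ) :
    Coded.enc S (x, y) = pr (Coded.enc S x) (Coded.enc S y) := rfl

omit [DOSemiring N] [IsACA S] in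
@[simp] theorem enc_inj {x y : Γ} : Coded.enc S x = Coded.enc S y ↔ x = y :=
  Coded.enc_injective.eq_iff

@[simp] theorem enc_num (x : N) : Coded.enc S x = x := rfl

/-- A map between coded types whose graph is in `S`. Predicates are maps to `Prop`. -/
@[fun_prop]
def IsDef (S : Set (Set N)) [IsACA S] {Γ Δ : Type*} [Coded S Γ] [Coded S Δ] (f : Γ → Δ) : Prop :=
  {p | ∃ x, p = pr (Coded.enc S x) (Coded.enc S (f x))} ∈ S

theorem IsDef.comp_aux {f : Δ → Θ} {g : Γ → Δ} (hf : IsDef S f) (hg : IsDef S g) :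
    IsDef S (fun x => f (g x)) := by
  have := comprehension₂ (.exN 1 (.exN 2 (.exN 3 (.and (.eq (.var 0) (prT (.var 1) (.var 3)))
      (.and (.mem (prT (.var 1) (.var 2)) 0) (.mem (prT (.var 2) (.var 3)) 1))))))
      ⟨trivial, trivial, trivial⟩ hg hf (0 : N)
  unfold IsDef
  convert this using 1
  ext a
  simp [ASat]

@[fun_prop]
protected theorem IsDef.id : IsDef S (fun x : Γ => x) := by
  have := comprehension₂ (.exN 1 (.and (.eq (.var 0) (prT (.var 1) (.var 1)))
      (.mem (.var 1) 0)))
      ⟨trivial, trivial⟩ (Coded.range_mem (S := S) (Γ := Γ)) univ_mem (0 : N)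
  unfold IsDef
  convert this using 1
  ext a
  simp [ASat]

@[fun_prop]
protected theorem IsDef.const (y : Δ) : IsDef S (fun _ : Γ => y) := by
  have := comprehension₂ (.exN 1 (.and (.eq (.var 0) (prT (.var 1) (.var 2)))
      (.mem (.var 1) 0)))
      ⟨trivial, trivial⟩ (Coded.range_mem (S := S) (Γ := Γ)) univ_mem (Coded.enc S y)
  unfold IsDef
  convert this using 1
  ext a
  simp [ASat]

@[fun_prop]
protected theorem IsDef.comp {f : Δ → Θ} {g : Γ → Δ} (hf : IsDef S f) (hg : IsDef S g) :
    IsDef S (fun x => f (g x)) := hf.comp_aux hg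

@[fun_prop]
theorem IsDef.prodMk {f : Γ → Δ} {g : Γ → Θ} (hf : IsDef S f) (hg : IsDef S g) :
    IsDef S (fun x => (f x, g x)) := by
  have := comprehension₂ (.exN 1 (.exN 2 (.exN 3 (.and (.eq (.var 0) (prT (.var 1)
      (prT (.var 2) (.var 3))))
      (.and (.mem (prT (.var 1) (.var 2)) 0) (.mem (prT (.var 1) (.var 3)) 1))))))
      ⟨trivial, trivial, trivial⟩ hf hg (0 : N)
  unfold IsDef
  convert this using 1
  ext a
  simp [ASat]

protected theorem IsDef.fst' : IsDef S (Prod.fst : Γ × Δ → Γ) := by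
  have := comprehension₂ (.exN 1 (.exN 2 (.and (.eq (.var 0) (prT (prT (.var 1) (.var 2))
      (.var 1))) (.and (.mem (.var 1) 0) (.mem (.var 2) 1)))))
      ⟨trivial, trivial, trivial⟩ (Coded.range_mem (S := S) (Γ := Γ))
      (Coded.range_mem (S := S) (Γ := Δ)) (0 : N)
  unfold IsDef
  convert this using 1
  ext a
  simp only [ASat, tv_var, tv_prT, Set.mem_ofPred_eq, Prod.exists]
  constructor
  · rintro ⟨x, y, rfl⟩; exact ⟨Coded.enc S x, Coded.enc S y, by simp, by simp, by simp⟩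
  · rintro ⟨x, y, h1, h2, h3⟩
    simp at h1 h2 h3
    obtain ⟨x, rfl⟩ := h2
    obtain ⟨y, rfl⟩ := h3
    exact ⟨x, y, h1⟩

protected theorem IsDef.snd' : IsDef S (Prod.snd : Γ × Δ → Δ) := by
  have := comprehension₂ (.exN 1 (.exN 2 (.and (.eq (.var 0) (prT (prT (.var 1) (.var 2))
      (.var 2))) (.and (.mem (.var 1) 0) (.mem (.var 2) 1)))))
      ⟨trivial, trivial, trivial⟩ (Coded.range_mem (S := S) (Γ := Γ))
      (Coded.range_mem (S := S) (Γ := Δ)) (0 : N)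
  unfold IsDef
  convert this using 1
  ext a
  simp only [ASat, tv_var, tv_prT, Set.mem_ofPred_eq, Prod.exists]
  constructor
  · rintro ⟨x, y, rfl⟩; exact ⟨Coded.enc S x, Coded.enc S y, by simp, by simp, by simp⟩
  · rintro ⟨x, y, h1, h2, h3⟩
    simp at h1 h2 h3
    obtain ⟨x, rfl⟩ := h2
    obtain ⟨y, rfl⟩ := h3
    exact ⟨x, y, h1⟩

@[fun_prop]
protected theorem IsDef.fst {f : Γ → Δ × Θ} (hf : IsDef S f) : IsDef S (fun x => (f x).1) :=
  IsDef.fst'.comp hf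

@[fun_prop]
protected theorem IsDef.snd {f : Γ → Δ × Θ} (hf : IsDef S f) : IsDef S (fun x => (f x).2) :=
  IsDef.snd'.comp hf

/-- A predicate is definable iff the set of codes of its elements is in `S`. -/
theorem isDef_prop_iff {P : Γ → Prop} : IsDef S P ↔ {a | ∃ x, a = Coded.enc S x ∧ P x} ∈ S := by
  constructor
  · intro h
    have := comprehension₂ (.mem (prT (.var 0) .one) 0) trivial h h (0 : N)
    convert this using 1
    ext a
    simp [ASat, Coded.enc]
  · intro h
    have := comprehension₂ (.exN 1 (.and (.mem (.var 1) 1) (.or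
      (.and (.eq (.var 0) (prT (.var 1) .one)) (.mem (.var 1) 0))
      (.and (.eq (.var 0) (prT (.var 1) .zero)) (.not (.mem (.var 1) 0))))))
      ⟨trivial, ⟨trivial, trivial⟩, ⟨trivial, trivial⟩⟩ h
      (Coded.range_mem (S := S) (Γ := Γ)) (0 : N)
    unfold IsDef
    convert this using 1
    ext a
    simp [ASat, Coded.enc]
    refine exists_congr fun x => ?_
    by_cases hx : P x <;> simp [hx]

theorem mem_iff_isDef {A : Set N} : A ∈ S ↔ IsDef S (fun a => a ∈ A) := by
  rw [isDef_prop_iff]; simp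

theorem setOf_mem {P : N → Prop} (h : IsDef S P) : {a | P a} ∈ S := mem_iff_isDef.mpr h

@[fun_prop]
protected theorem IsDef.and {P Q : Γ → Prop} (hP : IsDef S P) (hQ : IsDef S Q) :
    IsDef S (fun x => P x ∧ Q x) := by
  rw [isDef_prop_iff] at *
  have := comprehension₂ (.and (.mem (.var 0) 0) (.mem (.var 0) 1)) ⟨trivial, trivial⟩ hP hQ (0 : N)
  convert this using 1
  ext a
  simp [ASat]
  aesop

@[fun_prop]
protected theorem IsDef.not {P : Γ → Prop} (hP : IsDef S P) : IsDef S (fun x => ¬ P x) := by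
  rw [isDef_prop_iff] at *
  have := comprehension₂ (.and (.not (.mem (.var 0) 0)) (.mem (.var 0) 1)) ⟨trivial, trivial⟩ hP
    (Coded.range_mem (S := S) (Γ := Γ)) (0 : N)
  convert this using 1
  ext a
  simp [ASat]
  constructor
  · rintro ⟨x, rfl, h⟩; exact ⟨fun y hy => by rwa [← Coded.enc_injective hy], x, rfl⟩
  · rintro ⟨h, x, rfl⟩; exact ⟨x, rfl, h x rfl⟩

@[fun_prop]
protected theorem IsDef.or {P Q : Γ → Prop} (hP : IsDef S P) (hQ : IsDef S Q) :
    IsDef S (fun x => P x ∨ Q x) := by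
  simp only [or_iff_not_and_not]; fun_prop

@[fun_prop]
protected theorem IsDef.imp {P Q : Γ → Prop} (hP : IsDef S P) (hQ : IsDef S Q) :
    IsDef S (fun x => P x → Q x) := by
  simp only [imp_iff_not_or]; fun_prop

@[fun_prop]
protected theorem IsDef.iff {P Q : Γ → Prop} (hP : IsDef S P) (hQ : IsDef S Q) :
    IsDef S (fun x => P x ↔ Q x) := by
  simp only [iff_iff_and_or_not_and_not]; fun_prop

@[fun_prop]
protected theorem IsDef.exists {P : Γ → Δ → Prop} (hP : IsDef S (fun p : Γ × Δ => P p.1 p.2)) :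
    IsDef S (fun x => ∃ y, P x y) := by
  rw [isDef_prop_iff] at *
  have := comprehension₂ (.exN 1 (.mem (prT (.var 0) (.var 1)) 0)) trivial hP hP (0 : N)
  convert this using 1
  ext a
  simp [ASat]

@[fun_prop]
protected theorem IsDef.forall {P : Γ → Δ → Prop} (hP : IsDef S (fun p : Γ × Δ => P p.1 p.2)) :
    IsDef S (fun x => ∀ y, P x y) := by
  have : IsDef S (fun x => ¬ ∃ y, ¬ P x y) := by fun_prop
  simpa using this

@[fun_prop]
protected theorem IsDef.eq {f g : Γ → Δ} (hf : IsDef S f) (hg : IsDef S g) :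
    IsDef S (fun x => f x = g x) := by
  rw [isDef_prop_iff] at *
  have := comprehension₂ (.exN 1 (.and (.mem (prT (.var 0) (.var 1)) 0)
    (.mem (prT (.var 0) (.var 1)) 1))) ⟨trivial, trivial⟩ hf hg (0 : N)
  convert this using 1
  ext a
  simp [ASat]
  aesop

@[fun_prop]
protected theorem IsDef.lt {f g : Γ → N} (hf : IsDef S f) (hg : IsDef S g) :
    IsDef S (fun x => f x < g x) := by
  rw [isDef_prop_iff] at *
  have := comprehension₂ (.exN 1 (.exN 2 (.and (.lt (.var 1) (.var 2))
    (.and (.mem (prT (.var 0) (.var 1)) 0)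
    (.mem (prT (.var 0) (.var 2)) 1))))) ⟨trivial, trivial, trivial⟩ hf hg (0 : N)
  convert this using 1
  ext a
  simp [ASat]
  aesop

@[fun_prop]
protected theorem IsDef.le {f g : Γ → N} (hf : IsDef S f) (hg : IsDef S g) :
    IsDef S (fun x => f x ≤ g x) := by
  simp only [← not_lt]; fun_prop

@[fun_prop]
protected theorem IsDef.add {f g : Γ → N} (hf : IsDef S f) (hg : IsDef S g) :
    IsDef S (fun x => f x + g x) := by
  have := comprehension₂ (.exN 1 (.exN 2 (.exN 3 (.and (.eq (.var 0) (prT (.var 1)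
      (.add (.var 2) (.var 3))))
      (.and (.mem (prT (.var 1) (.var 2)) 0) (.mem (prT (.var 1) (.var 3)) 1))))))
      ⟨trivial, trivial, trivial⟩ hf hg (0 : N)
  unfold IsDef
  convert this using 1
  ext a
  simp [ASat]

@[fun_prop]
protected theorem IsDef.mul {f g : Γ → N} (hf : IsDef S f) (hg : IsDef S g) :
    IsDef S (fun x => f x * g x) := by
  have := comprehension₂ (.exN 1 (.exN 2 (.exN 3 (.and (.eq (.var 0) (prT (.var 1)
      (.mul (.var 2) (.var 3))))
      (.and (.mem (prT (.var 1) (.var 2)) 0) (.mem (prT (.var 1) (.var 3)) 1))))))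
      ⟨trivial, trivial, trivial⟩ hf hg (0 : N)
  unfold IsDef
  convert this using 1
  ext a
  simp [ASat]

@[fun_prop]
protected theorem IsDef.pr {f g : Γ → N} (hf : IsDef S f) (hg : IsDef S g) :
    IsDef S (fun x => pr (f x) (g x)) := by
  unfold SOA.pr; fun_prop

/-- A map with definable graph is definable. -/
theorem IsDef.of_graph {f : Γ → Δ} (h : IsDef S (fun p : Γ × Δ => f p.1 = p.2)) : IsDef S f := by
  rw [isDef_prop_iff] at h
  unfold IsDef
  convert h using 1
  ext a
  simp [Coded.enc]

open Classical in
@[fun_prop]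
protected theorem IsDef.ite {P : Γ → Prop} [∀ x, Decidable (P x)] {f g : Γ → Δ} (hP : IsDef S P)
    (hf : IsDef S f) (hg : IsDef S g) : IsDef S (fun x => if P x then f x else g x) := by
  apply IsDef.of_graph
  have : IsDef S (fun p : Γ × Δ => (P p.1 ∧ f p.1 = p.2) ∨ (¬ P p.1 ∧ g p.1 = p.2)) := by fun_prop
  convert this using 2 with p
  by_cases h : P p.1 <;> simp [h]

/-- The induction principle for definable predicates. -/
protected theorem IsDef.induction {P : N → Prop} (h : IsDef S P) (h0 : P 0)
    (hs : ∀ a, P a → P (a + 1)) :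
    ∀ a, P a :=
  IsACA.induction (S := S) _ (setOf_mem h) h0 hs

end

/-! ### Least elements, finite sets and recursion -/

section
variable {N : Type u} [DOSemiring N] {S : Set (Set N)} [IsACA S]
variable {Γ Δ Θ : Type*} [Coded S Γ] [Coded S Δ] [Coded S Θ]

theorem IsDef.exists_least {P : N → Prop} (h : IsDef S P) {a : N} (ha : P a) :
    ∃ a, P a ∧ ∀ b, b < a → ¬ P b := by
  by_contra hc
  push Not at hc
  have key : ∀ a, ∀ b, b < a → ¬ P b := by
    refine IsDef.induction (S := S) (by fun_prop) (fun b hb => absurd hb not_lt_zero) ?_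
    intro a ih b hb
    rcases (lt_succ_iff.mp hb).lt_or_eq with h | rfl
    · exact ih b h
    · intro hb
      obtain ⟨c, hc, hP⟩ := hc b hb
      exact ih c hc hP
  exact key (a + 1) a (lt_add_one a) ha

open Classical in
/-- The least number satisfying `P`, and `0` if there is none. -/
noncomputable def least (P : N → Prop) : N :=
  if h : ∃ a, P a ∧ ∀ b, b < a → ¬ P b then h.choose else 0

theorem least_eq_iff {P : N → Prop} {a : N} : least P = a ↔
    (P a ∧ ∀ b, b < a → ¬ P b) ∨ ((¬ ∃ a, P a ∧ ∀ b, b < a → ¬ P b) ∧ a = 0) := by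
  unfold least
  split_ifs with h
  · simp only [h, not_true_eq_false, false_and, or_false]
    constructor
    · rintro rfl; exact h.choose_spec
    · rintro ⟨h1, h2⟩
      obtain ⟨h3, h4⟩ := h.choose_spec
      rcases lt_trichotomy h.choose a with h5 | h5 | h5
      · exact absurd h3 (h2 _ h5)
      · exact h5
      · exact absurd h1 (h4 _ h5)
  · simp only [h, not_false_eq_true, true_and]
    constructor
    · rintro rfl; exact Or.inr rfl
    · rintro (h1 | rfl)
      · exact absurd ⟨a, h1⟩ h
      · rfl

theorem IsDef.least_spec {P : N → Prop} (h : IsDef S P) {a : N} (ha : P a) :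
    P (least P) ∧ ∀ b, P b → least P ≤ b := by
  have := h.exists_least ha
  unfold least
  rw [dif_pos this]
  exact ⟨this.choose_spec.1, fun b hb => not_lt.mp fun hlt => this.choose_spec.2 b hlt hb⟩

@[fun_prop]
protected theorem IsDef.least {P : Γ → N → Prop} (h : IsDef S (fun p : Γ × N => P p.1 p.2)) :
    IsDef S (fun x => least (P x)) := by
  apply IsDef.of_graph
  simp only [least_eq_iff]
  fun_prop

theorem exists_common_multiple (S : Set (Set N)) [IsACA S] (b : N) :
    ∃ m : N, 0 < m ∧ ∀ i, 0 < i → i ≤ b → ∃ q, m = i * q := by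
  revert b
  refine IsDef.induction (S := S) (by fun_prop)
    ⟨1, zero_lt_one, fun i h1 h2 => absurd h1 (not_lt.mpr h2)⟩ ?_
  rintro b ⟨m, hm, h⟩
  refine ⟨m * (b + 1), by positivity, fun i h1 h2 => ?_⟩
  rcases h2.lt_or_eq with h2 | rfl
  · obtain ⟨q, rfl⟩ := h i h1 (lt_succ_iff.mp h2)
    exact ⟨q * (b + 1), by ring⟩
  · exact ⟨m, by ring⟩

/-- If `m` is divisible by the difference of the indices `p` and `p'`, then `m (p + 1) + 1` is
prime to `m (p' + 1) + 1`. -/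
theorem dvd_of_dvd_mul_beta {m p p' n d c : N} (hd : p' = p + d ∨ p = p' + d) (hc : m = d * c)
    (h : (m * (p + 1) + 1) ∣ n * (m * (p' + 1) + 1)) : (m * (p + 1) + 1) ∣ n := by
  -- the modulus is prime to `m`
  have key : ∀ k, (m * (p + 1) + 1) ∣ k * m → (m * (p + 1) + 1) ∣ k := by
    intro k hk
    have h1 : (m * (p + 1) + 1) ∣ (k * m) * (p + 1) := hk.mul_right _
    have h2 : (m * (p + 1) + 1) ∣ (k * m) * (p + 1) + k := ⟨k, by ring⟩
    obtain ⟨u, hu⟩ := h1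
    obtain ⟨w, hw⟩ := h2
    rw [hu] at hw
    have hle : u ≤ w := by
      by_contra hlt
      push Not at hlt
      have : (m * (p + 1) + 1) * w < (m * (p + 1) + 1) * u := by gcongr
      rw [← hw] at this
      exact absurd this (not_lt.mpr le_self_add)
    obtain ⟨e, rfl⟩ := exists_add_of_le hle
    rw [mul_add (m * (p + 1) + 1)] at hw
    exact ⟨e, add_left_cancel hw⟩
  have h3 : (m * (p + 1) + 1) ∣ n * (m * d) := by
    rcases hd with rfl | hd
    · obtain ⟨u, hu⟩ := h
      have h5 : n * (m * (p + d + 1) + 1) = (m * (p + 1) + 1) * n + n * (m * d) := by ring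
      rw [h5] at hu
      have hle : n ≤ u := by
        by_contra hlt
        push Not at hlt
        have : (m * (p + 1) + 1) * u < (m * (p + 1) + 1) * n := by gcongr
        rw [← hu] at this
        exact absurd this (not_lt.mpr le_self_add)
      obtain ⟨e, rfl⟩ := exists_add_of_le hle
      rw [mul_add (m * (p + 1) + 1)] at hu
      exact ⟨e, add_left_cancel hu⟩
    · obtain ⟨u, hu⟩ := h
      have h5 : (m * (p + 1) + 1) * n = n * (m * (p' + 1) + 1) + n * (m * d) := by
        rw [hd]; ring
      rw [hu] at h5
      have hle : u ≤ n := by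
        by_contra hlt
        push Not at hlt
        have : (m * (p + 1) + 1) * n < (m * (p + 1) + 1) * u := by gcongr
        rw [h5] at this
        exact absurd this (not_lt.mpr le_self_add)
      obtain ⟨e, rfl⟩ := exists_add_of_le hle
      rw [mul_add (m * (p + 1) + 1)] at h5
      exact ⟨e, (add_left_cancel h5).symm⟩
  have h4 : (m * (p + 1) + 1) ∣ n * m * m := by
    have : n * m * m = (n * (m * d)) * c := by
      nth_rewrite 2 [hc]; ring
    rw [this]
    exact h3.mul_right _
  exact key _ (key _ h4)

/-- Every bounded part of a set of the model is coded. -/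
theorem exists_code {A : Set N} (hA : A ∈ S) (b : N) : ∃ s, ∀ p, InF s p ↔ p < b ∧ p ∈ A := by
  obtain ⟨m, hm, hdiv⟩ := exists_common_multiple S b
  have hA' := mem_iff_isDef.mp hA
  suffices h : ∀ c, ∃ n : N, ∀ p, p < b → ((∃ q, n = (m * (p + 1) + 1) * q) ↔ p < c ∧ p ∈ A) by
    obtain ⟨n, hn⟩ := h b
    refine ⟨pr b (pr m n), fun p => ?_⟩
    constructor
    · rintro ⟨k, m', n', h1, h2, h3⟩
      simp only [pr_eq_iff] at h1
      obtain ⟨rfl, rfl, rfl⟩ := h1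
      exact (hn p h2).mp h3
    · intro h
      exact ⟨b, m, n, rfl, h.1, (hn p h.1).mpr h⟩
  refine IsDef.induction (S := S) (by fun_prop) ⟨1, ?_⟩ ?_
  · intro p hp
    refine ⟨?_, fun h => absurd h.1 not_lt_zero⟩
    rintro ⟨q, hq⟩
    exfalso
    rcases eq_zero_or_succ q with rfl | ⟨r, rfl⟩
    · simp at hq
    · have : (m * (p + 1) + 1) * (r + 1) = 1 + (m * (p + 1) * (r + 1) + r) := by ring
      rw [this] at hq
      have := left_eq_add.mp hq
      have h2 : 0 < m * (p + 1) * (r + 1) + r := by positivity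
      exact h2.ne' this
  · rintro c ⟨n, hn⟩
    by_cases hc : c ∈ A ∧ c < b
    · refine ⟨n * (m * (c + 1) + 1), fun p hp => ?_⟩
      constructor
      · intro hq
        rcases eq_or_ne p c with rfl | hpc
        · exact ⟨lt_add_one p, hc.1⟩
        · have : ∃ d, (c = p + d ∨ p = c + d) ∧ 0 < d ∧ d ≤ b := by
            rcases lt_or_gt_of_ne hpc with h | h
            · obtain ⟨d, rfl⟩ := exists_add_of_le h.le
              refine ⟨d, Or.inl rfl, ?_, ?_⟩
              · exact pos_of_lt_add_right h
              · exact le_trans le_add_self hc.2.le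
            · obtain ⟨d, rfl⟩ := exists_add_of_le h.le
              refine ⟨d, Or.inr rfl, ?_, ?_⟩
              · exact pos_of_lt_add_right h
              · exact le_trans le_add_self hp.le
          obtain ⟨d, hd, hd0, hdb⟩ := this
          obtain ⟨q, hqm⟩ := hdiv d hd0 hdb
          have := (hn p hp).mp (dvd_of_dvd_mul_beta hd hqm hq)
          exact ⟨this.1.trans (lt_add_one c), this.2⟩
      · rintro ⟨h1, h2⟩
        rcases (lt_succ_iff.mp h1).lt_or_eq with h3 | rfl
        · obtain ⟨q, rfl⟩ := (hn p hp).mpr ⟨h3, h2⟩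
          exact ⟨q * (m * (c + 1) + 1), by ring⟩
        · exact ⟨n, by ring⟩
    · refine ⟨n, fun p hp => ?_⟩
      rw [hn p hp]
      constructor
      · rintro ⟨h1, h2⟩; exact ⟨h1.trans (lt_add_one c), h2⟩
      · rintro ⟨h1, h2⟩
        rcases (lt_succ_iff.mp h1).lt_or_eq with h3 | rfl
        · exact ⟨h3, h2⟩
        · exact absurd ⟨h2, hp⟩ hc

@[fun_prop]
protected theorem IsDef.inF {f g : Γ → N} (hf : IsDef S f) (hg : IsDef S g) :
    IsDef S (fun x => InF (f x) (g x)) := by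
  unfold InF; fun_prop

/-- The least code of the finite set with the given elements. -/
noncomputable def codeOf (A : Set N) : N := least fun s => ∀ p, InF s p ↔ p ∈ A

theorem inF_codeOf {A : Set N} (hA : A ∈ S) {b : N} (hb : ∀ a ∈ A, a < b) {p : N} :
    InF (codeOf A) p ↔ p ∈ A := by
  have hA' := mem_iff_isDef.mp hA
  obtain ⟨s, hs⟩ := exists_code hA b
  have := (IsDef.least_spec (S := S) (P := fun s => ∀ p, InF s p ↔ p ∈ A) (by fun_prop) (a := s)
    (fun p => by rw [hs]; exact ⟨fun h => h.2, fun h => ⟨hb _ h, h⟩⟩)).1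
  exact this p

/-- The least code of the set coded by `s` enlarged by `p`. -/
noncomputable def ins (s p : N) : N := codeOf {q | InF s q ∨ q = p}

/-- The least code of the empty set. -/
noncomputable def emp : N := codeOf ∅

@[fun_prop]
protected theorem IsDef.ins {f g : Γ → N} (hf : IsDef S f) (hg : IsDef S g) :
    IsDef S (fun x => ins (f x) (g x)) := by
  unfold SOA.ins codeOf
  simp only [Set.mem_ofPred_eq]
  fun_prop

theorem inF_ins (S : Set (Set N)) [IsACA S] {s p q : N} : InF (ins s p) q ↔ InF s q ∨ q = p := by
  refine inF_codeOf (S := S) (A := {q | InF s q ∨ q = p}) (setOf_mem (by fun_prop)) (b := s + p + 1)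
    ?_
  rintro a (h | rfl)
  · exact h.lt.trans_le (by rw [add_assoc]; exact le_self_add)
  · exact lt_succ_iff.mpr le_add_self

theorem inF_emp (S : Set (Set N)) [IsACA S] {p : N} : ¬ InF emp p := by
  have : (∅ : Set N) ∈ S := setOf_mem (P := fun _ => False) (by fun_prop)
  unfold emp
  rw [inF_codeOf (S := S) this (b := 0) (by simp)]
  exact id

/-- The value at `i` of the finite function whose graph is coded by `s` (the least one, and `0` if
there is none). -/
noncomputable def val (s i : N) : N := least fun b => InF s (pr i b)

@[fun_prop]
protected theorem IsDef.val {f g : Γ → N} (hf : IsDef S f) (hg : IsDef S g) :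
    IsDef S (fun x => val (f x) (g x)) := by
  unfold SOA.val; fun_prop

theorem val_eq (S : Set (Set N)) [IsACA S] {s i b : N} (h : InF s (pr i b))
    (hu : ∀ b', InF s (pr i b') → b' = b) :
    val s i = b :=
  hu _ (IsDef.least_spec (S := S) (P := fun b => InF s (pr i b)) (by fun_prop) h).1

theorem val_congr {s s' i : N} (h : ∀ b, InF s (pr i b) ↔ InF s' (pr i b)) :
    val s i = val s' i := by
  unfold val; simp only [h]

/-- The code of the finite sequence `⟨f 0, …, f (k - 1)⟩`. -/
noncomputable def icode (f : N → N) (k : N) : N := codeOf {p | ∃ i, i < k ∧ p = pr i (f i)}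

@[fun_prop]
protected theorem IsDef.icode {f : Γ → N → N} {k : Γ → N}
    (hf : IsDef S (fun p : Γ × N => f p.1 p.2))
    (hk : IsDef S k) : IsDef S (fun x => icode (f x) (k x)) := by
  unfold SOA.icode codeOf
  simp only [Set.mem_ofPred_eq]
  fun_prop

theorem IsDef.exists_bound {f : N → N} (hf : IsDef S f) (k : N) : ∃ b, ∀ i, i < k → f i < b := by
  revert k
  refine IsDef.induction (S := S) (by fun_prop) ⟨0, fun i hi => absurd hi not_lt_zero⟩ ?_
  rintro k ⟨b, hb⟩
  refine ⟨b + f k + 1, fun i hi => ?_⟩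
  rcases (lt_succ_iff.mp hi).lt_or_eq with h | rfl
  · exact (hb i h).trans_le (by rw [add_assoc]; exact le_self_add)
  · exact lt_succ_iff.mpr le_add_self

theorem inF_icode {f : N → N} (hf : IsDef S f) {k p : N} :
    InF (icode f k) p ↔ ∃ i, i < k ∧ p = pr i (f i) := by
  obtain ⟨b, hb⟩ := IsDef.exists_bound (S := S) (f := fun i => pr i (f i)) (by fun_prop) k
  refine inF_codeOf (S := S) (A := {p | ∃ i, i < k ∧ p = pr i (f i)}) (setOf_mem (by fun_prop))
    (b := b) ?_
  rintro a ⟨i, hi, rfl⟩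
  exact hb i hi

theorem inF_icode_pr {f : N → N} (hf : IsDef S f) {k i b : N} :
    InF (icode f k) (pr i b) ↔ i < k ∧ b = f i := by
  rw [inF_icode hf]
  simp only [pr_eq_iff]
  constructor
  · rintro ⟨i, h, rfl, rfl⟩; exact ⟨h, rfl⟩
  · rintro ⟨h, rfl⟩; exact ⟨i, h, rfl, rfl⟩

theorem icode_zero (f : N → N) : icode f 0 = emp := by
  unfold icode emp
  congr 1
  ext p
  simp

theorem icode_succ {f : N → N} (hf : IsDef S f) (k : N) :
    icode f (k + 1) = ins (icode f k) (pr k (f k)) := by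
  unfold ins
  conv_lhs => unfold icode
  congr 1
  ext p
  simp only [inF_icode hf, Set.mem_ofPred_eq, lt_succ_iff, le_iff_lt_or_eq]
  constructor
  · rintro ⟨i, h | rfl, rfl⟩
    · exact Or.inl ⟨i, h, rfl⟩
    · exact Or.inr rfl
  · rintro (⟨i, h, rfl⟩ | rfl)
    · exact ⟨i, Or.inl h, rfl⟩
    · exact ⟨k, Or.inr rfl, rfl⟩

theorem icode_congr {f g : N → N} {k : N} (h : ∀ i, i < k → f i = g i) : icode f k = icode g k := by
  unfold icode
  congr 1
  ext p
  exact exists_congr fun i => and_congr_right fun hi => by rw [h i hi]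

theorem val_icode {f : N → N} (hf : IsDef S f) {k i : N} (h : i < k) : val (icode f k) i = f i :=
  val_eq S ((inF_icode_pr hf).mpr ⟨h, rfl⟩) fun _ hb => ((inF_icode_pr hf).mp hb).2

/-- Definition by primitive recursion with parameters. -/
theorem IsDef.exists_rec [Nonempty Δ] {a : Γ → Δ} {g : Γ × N × Δ → Δ} (ha : IsDef S a)
    (hg : IsDef S g) : ∃ h : Γ × N → Δ, IsDef S h ∧ (∀ x, h (x, 0) = a x) ∧
      ∀ x t, h (x, t + 1) = g (x, t, h (x, t)) := by
  have henc : IsDef S (fun y : Δ => Coded.enc S y) := by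
    unfold IsDef
    have := IsDef.id (S := S) (Γ := Δ)
    exact this
  -- `s` codes a table in which every entry is initial or follows from an earlier one
  let T : Γ → N → Prop := fun x s => ∀ (i : N) (y : Δ), InF s (pr i (Coded.enc S y)) →
    (i = 0 ∧ y = a x) ∨ ∃ (j : N) (z : Δ), i = j + 1 ∧ InF s (pr j (Coded.enc S z)) ∧
      y = g (x, j, z)
  let R : Γ → N → Δ → Prop := fun x t y => ∃ s, T x s ∧ InF s (pr t (Coded.enc S y))
  have hR : IsDef S (fun p : Γ × N × Δ => R p.1 p.2.1 p.2.2) := by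
    simp only [R, T]; fun_prop
  have hR0 : ∀ x y, R x 0 y → y = a x := by
    rintro x y ⟨s, hs, h⟩
    rcases hs 0 y h with ⟨-, h⟩ | ⟨j, z, h, -⟩
    · exact h
    · exact absurd h (zero_lt_succ j).ne
  have hRs : ∀ x t y, R x (t + 1) y → ∃ z, R x t z ∧ y = g (x, t, z) := by
    rintro x t y ⟨s, hs, h⟩
    rcases hs _ y h with ⟨h, -⟩ | ⟨j, z, h', hz, rfl⟩
    · exact absurd h (zero_lt_succ t).ne'
    · obtain rfl := add_right_cancel h'
      exact ⟨z, ⟨s, hs, hz⟩, rfl⟩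
  have hex : ∀ x t, ∃ y, R x t y := by
    intro x
    refine IsDef.induction (S := S) (by fun_prop)
      ⟨a x, ins emp (pr 0 (Coded.enc S (a x))), ?_, ?_⟩ ?_
    · intro i y hi
      simp [inF_ins S, inF_emp S] at hi
      exact Or.inl hi
    · simp [inF_ins S]
    · rintro t ⟨y, s, hs, h⟩
      refine ⟨g (x, t, y), ins s (pr (t + 1) (Coded.enc S (g (x, t, y)))), ?_, ?_⟩
      · intro i z hi
        simp only [inF_ins S, pr_eq_iff, enc_inj] at hi
        simp only [inF_ins S]
        rcases hi with hi | ⟨rfl, rfl⟩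
        · rcases hs i z hi with h1 | ⟨j, w, h1, h2, h3⟩
          · exact Or.inl h1
          · exact Or.inr ⟨j, w, h1, Or.inl h2, h3⟩
        · exact Or.inr ⟨t, y, rfl, Or.inl h, rfl⟩
      · simp [inF_ins S]
  have huniq : ∀ x t, ∀ y z, R x t y → R x t z → y = z := by
    intro x
    refine IsDef.induction (S := S) (by fun_prop) ?_ ?_
    · intro y z hy hz; rw [hR0 x y hy, hR0 x z hz]
    · intro t ih y z hy hz
      obtain ⟨y', hy', rfl⟩ := hRs x t y hy
      obtain ⟨z', hz', rfl⟩ := hRs x t z hz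
      rw [ih y' z' hy' hz']
  choose h hh using hex
  refine ⟨fun p => h p.1 p.2, ?_, ?_, ?_⟩
  · apply IsDef.of_graph
    have : IsDef S (fun p : (Γ × N) × Δ => R p.1.1 p.1.2 p.2) := by fun_prop
    convert this using 2 with p
    exact ⟨fun e => e ▸ hh _ _, fun e => huniq _ _ _ _ (hh _ _) e⟩
  · intro x; exact hR0 x _ (hh x 0)
  · intro x t
    obtain ⟨z, hz, e⟩ := hRs x t _ (hh x (t + 1))
    dsimp only
    rw [e, huniq x t z _ hz (hh x t)]

/-- Definition by primitive recursion. -/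
theorem IsDef.exists_rec' [Nonempty Δ] (a : Δ) {g : N × Δ → Δ} (hg : IsDef S g) :
    ∃ h : N → Δ, IsDef S h ∧ h 0 = a ∧ ∀ t, h (t + 1) = g (t, h t) := by
  obtain ⟨h, h1, h2, h3⟩ := IsDef.exists_rec (S := S) (Γ := N) (a := fun _ => a)
    (g := fun p => g p.2) (by fun_prop) (by fun_prop)
  exact ⟨fun t => h (0, t), by fun_prop, h2 0, h3 0⟩

end

/-! ### Determinacy for games with ranked positions -/

section
variable {N : Type u} [DOSemiring N] {S : Set (Set N)}

/-- The graph of a function, as a set of numbers. -/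
def graph (f : N → N) : Set N := {p | ∃ x, p = pr x (f x)}

@[simp] theorem pr_mem_graph {f : N → N} {i j : N} : pr i j ∈ graph f ↔ j = f i := by
  constructor
  · rintro ⟨x, h⟩; simp at h; rw [h.2, h.1]
  · rintro rfl; exact ⟨i, rfl⟩

variable [IsACA S]

theorem isPoint_iff (hS : S.Nonempty) {F : Set N} :
    IsPoint (toL2 S hS) F ↔ ∃ f : N → N, IsDef S f ∧ F = graph f := by
  constructor
  · rintro ⟨h1, h2, h3⟩
    choose f hf hf' using h3
    have : F = graph f := by
      ext p
      constructor
      · intro hp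
        obtain ⟨i, j, rfl⟩ := h2 p hp
        exact ⟨i, by rw [← hf' i j hp]; rfl⟩
      · rintro ⟨i, rfl⟩; exact hf i
    refine ⟨f, ?_, this⟩
    have h1' : F ∈ S := h1
    rw [this] at h1'
    exact h1'
  · rintro ⟨f, hf, rfl⟩
    refine ⟨hf, ?_, ?_⟩
    · rintro p ⟨i, rfl⟩; exact ⟨i, f i, rfl⟩
    · intro i
      exact ⟨f i, pr_mem_graph.mpr rfl, fun j hj => pr_mem_graph.mp hj⟩

theorem isInitialCode_graph {f : N → N} (hf : IsDef S f) {l s : N} :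
    @IsInitialCode N (DOSemiring.arith N) (graph f) l s ↔ s = icode f l := by
  have key : ∀ s, @CodesInitial N (DOSemiring.arith N) (graph f) l s ↔
      ∀ p, InF s p ↔ ∃ i, i < l ∧ p = pr i (f i) := by
    intro s
    refine forall_congr' fun p => iff_congr Iff.rfl ?_
    constructor
    · rintro ⟨i, j, h1, h2, rfl⟩
      exact ⟨i, h1, by rw [← pr_mem_graph.mp h2]; rfl⟩
    · rintro ⟨i, h1, rfl⟩
      exact ⟨i, f i, h1, pr_mem_graph.mpr rfl, rfl⟩
  have h := IsDef.least_spec (S := S) (P := fun s => ∀ p, InF s p ↔ ∃ i, i < l ∧ p = pr i (f i))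
    (by fun_prop) (fun p => inF_icode hf)
  change _ ∧ (∀ b, _ → icode f l ≤ b) at h
  constructor
  · rintro ⟨h1, h2⟩
    refine le_antisymm ?_ (h.2 s ((key s).mp h1))
    refine not_lt.mp fun hlt => h2 _ hlt ?_
    exact (key _).mpr h.1
  · rintro rfl
    exact ⟨(key _).mpr h.1, fun s' h1 h2 => absurd (h.2 s' ((key s').mp h2)) (not_le.mpr h1)⟩

theorem isPlay_graph {σ τ f : N → N} (hf : IsDef S f) :
    @IsPlay N (DOSemiring.arith N) (graph σ) (graph τ) (graph f) ↔
    ∀ k, (Even k → f k = σ (icode f k)) ∧ (¬ Even k → f k = τ (icode f k)) := by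
  constructor
  · intro h k
    have := h k (icode f k) (f k) ((isInitialCode_graph hf).mpr rfl) (pr_mem_graph.mpr rfl)
    exact ⟨fun e => pr_mem_graph.mp (this.1 e), fun e => pr_mem_graph.mp (this.2 e)⟩
  · intro h k s a h1 h2
    obtain rfl := (isInitialCode_graph hf).mp h1
    have h3 : a = f k := pr_mem_graph.mp h2
    subst h3
    exact ⟨fun e => pr_mem_graph.mpr ((h k).1 e), fun e => pr_mem_graph.mpr ((h k).2 e)⟩

/-- The play `f` follows the strategy `σ` of player I (if `b` holds) or of player II (if not). -/
def Follows (b : Prop) (σ f : N → N) : Prop := ∀ k, (Even k ↔ b) → f k = σ (icode f k)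

/-- The least value of `r` exists and is even. -/
def MinEven (r : N → N) : Prop := ∃ t, Even (r t) ∧ ∀ t', r t ≤ r t'

@[fun_prop]
protected theorem IsDef.even {Γ : Type*} [Coded S Γ] {f : Γ → N} (hf : IsDef S f) :
    IsDef S (fun x => Even (f x)) := by
  unfold Even; fun_prop

theorem icode_inj {f : N → N} (hf : IsDef S f) {k l : N} (h : icode f k = icode f l) : k = l := by
  have key : ∀ {k l}, icode f k = icode f l → ¬ k < l := by
    intro k l h hlt
    have := (inF_icode_pr hf (k := l) (i := k) (b := f k)).mpr ⟨hlt, rfl⟩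
    rw [← h, inF_icode_pr hf] at this
    exact lt_irrefl _ this.1
  exact le_antisymm (not_lt.mp (key h.symm)) (not_lt.mp (key h))

/-- Any play is a play against some strategy of the opponent. -/
theorem exists_opponent {f : N → N} (hf : IsDef S f) :
    ∃ τ : N → N, IsDef S τ ∧ ∀ k, f k = τ (icode f k) := by
  refine ⟨fun s => f (least fun k => s = icode f k), by fun_prop, fun k => ?_⟩
  have := (IsDef.least_spec (S := S) (P := fun l => icode f k = icode f l) (by fun_prop)
    (a := k) rfl).1
  dsimp only
  rw [← icode_inj hf this]

/-- A game in which each position `f ↾ k` carries a rank `ρ (f ↾ k, k)`, and player I wins iff the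
least rank met is even, is a game with payoff a finite difference of open sets. -/
theorem exists_winning_strategy (hS : S.Nonempty) (hdet : AllSigma01DiffDet (toL2 S hS))
    {ρ : N × N → N} (hρ : IsDef S ρ) :
    ∃ (b : Prop) (σ : N → N), IsDef S σ ∧ ∀ f, IsDef S f → Follows b σ f →
      (MinEven (fun k => ρ (icode f k, k)) ↔ b) := by
  -- `w` codes a position of length `k`, in the same way as `icode` does
  let Q : N → N → Prop := fun w k => w = codeOf {p | InF w p} ∧
    (∀ p, InF w p → ∃ i b, i < k ∧ p = pr i b) ∧ ∀ i, i < k → ∃ b, InF w (pr i b)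
  let B : Set N := {x | ∃ w k y, x = pr (pr w k) y ∧ Q w k ∧ ρ (w, k) ≤ y}
  let E : Set N := {x | ∃ w k p, x = pr p (pr w k) ∧ InF w p}
  have hB : B ∈ S := setOf_mem (by
    simp only [Q, codeOf, Set.mem_ofPred_eq]; fun_prop)
  have hE : E ∈ S := setOf_mem (by fun_prop)
  let θ : Formula := .and (.mem (prT (.var 0) (.var 1)) 0)
    (.allN 2 (.imp (.lt (.var 2) (.var 0)) (.imp (.mem (prT (.var 2) (.var 0)) 1)
      (.mem (.var 2) 2))))
  let ψ : Formula := .exN 0 θ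
  have hψ : IsSigma01 ψ := ⟨0, _, .and (.mem _ _) (.ballN (fun h => by
    simp [Term.Occurs] at h) (.imp (.mem _ _) (.mem _ _))), rfl⟩
  let V : ℕ → Set N := fun k => if k = 0 then B else E
  have hV : (toL2 S hS).IsAssignment V := fun k => by
    dsimp only [V]; split_ifs <;> assumption
  let P : N → Set N → Prop := fun y F => (toL2 S hS).Sat ψ
    (Function.update (fun _ => (0 : N)) 1 y) (Function.update V 2 F)
  have hP : ∀ y F, P y F ↔ ∃ w, pr w y ∈ B ∧ ∀ p, p < w → pr p w ∈ E → p ∈ F := by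
    intro y F
    refine exists_congr fun w => ?_
    rw [sat_iff_aSat S hS θ ⟨trivial, trivial, trivial, trivial⟩]
    simp [θ, ASat, V]
  have hPf : ∀ y f, IsDef S f → (P y (graph f) ↔ ∃ k, ρ (icode f k, k) ≤ y) := by
    intro y f hf
    rw [hP]
    constructor
    · rintro ⟨w, ⟨w', k, y', h1, h2, h3⟩, h4⟩
      simp only [pr_eq_iff] at h1
      obtain ⟨rfl, rfl⟩ := h1
      refine ⟨k, ?_⟩
      have h5 : ∀ p, InF w' p → p ∈ graph f := fun p hp =>
        h4 p (hp.lt.trans_le (left_le_pr _ _)) ⟨w', k, p, rfl, hp⟩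
      have : w' = icode f k := by
        rw [h2.1]
        unfold icode
        congr 1
        ext p
        constructor
        · intro hp
          obtain ⟨i, b, hi, rfl⟩ := h2.2.1 p hp
          exact ⟨i, hi, by rw [pr_mem_graph.mp (h5 _ hp)]⟩
        · rintro ⟨i, hi, rfl⟩
          obtain ⟨b, hb⟩ := h2.2.2 i hi
          have := pr_mem_graph.mp (h5 _ hb)
          subst this
          exact hb
      rwa [← this]
    · rintro ⟨k, hk⟩
      refine ⟨pr (icode f k) k, ⟨_, _, _, rfl, ⟨?_, ?_, ?_⟩, hk⟩, ?_⟩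
      · unfold icode
        congr 1
        ext p
        exact (inF_icode hf).symm
      · intro p hp
        obtain ⟨i, hi, rfl⟩ := (inF_icode hf).mp hp
        exact ⟨i, _, hi, rfl⟩
      · intro i hi
        exact ⟨f i, (inF_icode_pr hf).mpr ⟨hi, rfl⟩⟩
      · rintro p - ⟨w, k', p', h1, h2⟩
        simp only [pr_eq_iff] at h1
        obtain ⟨rfl, rfl, rfl⟩ := h1
        obtain ⟨i, hi, rfl⟩ := (inF_icode hf).mp h2
        exact pr_mem_graph.mpr rfl
  set n : N := ρ (emp, 0) with hn
  have hPn : ∀ f, IsDef S f → P n (graph f) := fun f hf =>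
    (hPf n f hf).mpr ⟨0, by rw [icode_zero]⟩
  have hpres : IsPresentation (toL2 S hS) n P := by
    intro F hF
    obtain ⟨f, hf, rfl⟩ := (isPoint_iff hS).mp hF
    refine ⟨hPn f hf, fun z y hzy _ hz => ?_⟩
    obtain ⟨k, hk⟩ := (hPf z f hf).mp hz
    exact (hPf y f hf).mpr ⟨k, hk.trans (le_of_lt hzy)⟩
  have hpay : ∀ f, IsDef S f → (@differencePayoff N (DOSemiring.arith N) n P (graph f) ↔
      MinEven fun k => ρ (icode f k, k)) := by
    intro f hf
    constructor
    · rintro ⟨y, h1, h2, h3, h4⟩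
      have h5 : P y (graph f) := by
        rcases h2 with rfl | h2
        · exact hPn f hf
        · exact h2
      obtain ⟨k, hk⟩ := (hPf y f hf).mp h5
      have h6 : ∀ k, y ≤ ρ (icode f k, k) := fun k => not_lt.mp fun hlt =>
        h3 _ hlt (Or.inr ((hPf _ f hf).mpr ⟨k, le_rfl⟩))
      have h7 : ρ (icode f k, k) = y := le_antisymm hk (h6 k)
      exact ⟨k, by dsimp only; rw [h7]; exact h4, fun t => by dsimp only; rw [h7]; exact h6 t⟩
    · rintro ⟨k, h1, h2⟩
      have h3 : ρ (icode f k, k) ≤ n := by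
        have := h2 0
        simp only [icode_zero] at this
        exact this
      refine ⟨ρ (icode f k, k), lt_or_eq_of_le h3, Or.inr ((hPf _ f hf).mpr ⟨k, le_rfl⟩), ?_, h1⟩
      intro z hz
      rintro (rfl | h4)
      · exact absurd hz (not_lt.mpr h3)
      · obtain ⟨k', hk'⟩ := (hPf z f hf).mp h4
        exact absurd (lt_of_le_of_lt hk' hz) (not_lt.mpr (h2 k'))
  rcases hdet ψ hψ 1 2 (fun _ => (0 : N)) V hV n hpres with ⟨σ, hσ, h⟩ | ⟨τ, hτ, h⟩
  · obtain ⟨σ, hσd, rfl⟩ := (isPoint_iff hS).mp hσ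
    refine ⟨True, σ, hσd, fun f hf hfol => ?_⟩
    obtain ⟨τ, hτd, hτ⟩ := exists_opponent hf
    rw [← hpay f hf]
    simp only [iff_true]
    refine h (graph τ) ((isPoint_iff hS).mpr ⟨τ, hτd, rfl⟩) (graph f)
      ((isPoint_iff hS).mpr ⟨f, hf, rfl⟩)
      ((isPlay_graph hf).mpr fun k => ⟨fun e => ?_, fun _ => hτ k⟩)
    exact hfol k (by simp [e])
  · obtain ⟨τ, hτd, rfl⟩ := (isPoint_iff hS).mp hτ
    refine ⟨False, τ, hτd, fun f hf hfol => ?_⟩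
    obtain ⟨σ, hσd, hσ⟩ := exists_opponent hf
    rw [← hpay f hf]
    simp only [iff_false]
    refine h (graph σ) ((isPoint_iff hS).mpr ⟨σ, hσd, rfl⟩) (graph f)
      ((isPoint_iff hS).mpr ⟨f, hf, rfl⟩)
      ((isPlay_graph hf).mpr fun k => ⟨fun _ => hσ k, fun e => ?_⟩)
    exact hfol k (by simp [e])

end

/-! ### Plays against a strategy, and a strategy played against itself -/

section
variable {N : Type u} [DOSemiring N]

theorem even_succ (S : Set (Set N)) [IsACA S] : ∀ a : N, Even (a + 1) ↔ ¬ Even a := by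
  have h2 : ∀ a : N, Even (a + 1 + 1) ↔ Even a := by
    intro a
    constructor
    · rintro ⟨r, hr⟩
      rcases eq_zero_or_succ r with rfl | ⟨s, rfl⟩
      · simp at hr
      · have : s + 1 + (s + 1) = s + s + 1 + 1 := by ring
        rw [this] at hr
        exact ⟨s, add_right_cancel (add_right_cancel hr)⟩
    · rintro ⟨r, rfl⟩
      exact ⟨r + 1, by ring⟩
  refine IsDef.induction (S := S) (by fun_prop) ?_ ?_
  · simp only [zero_add, Even.zero, not_true_eq_false, iff_false]
    rintro ⟨r, hr⟩
    rcases eq_zero_or_succ r with rfl | ⟨s, rfl⟩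
    · simp at hr
    · have h3 : s + 1 + (s + 1) = 1 + (s + s + 1) := by ring
      rw [h3] at hr
      exact (zero_lt_succ (s + s)).ne' (left_eq_add.mp hr)
  · intro a ih
    rw [h2, ih, not_not]

theorem even_add' (S : Set (Set N)) [IsACA S] (a : N) :
    ∀ b : N, Even (a + b) ↔ (Even a ↔ Even b) := by
  refine IsDef.induction (S := S) (by fun_prop) (by simp) ?_
  intro b ih
  rw [← add_assoc, even_succ S, even_succ S, ih]
  tauto

variable {S : Set (Set N)} [IsACA S]

/-- A play of a strategy for one player against moves `h` of the other. -/
theorem exists_follows (b : Prop) {σ h : N → N} (hσ : IsDef S σ) (hh : IsDef S h) :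
    ∃ f : N → N, IsDef S f ∧ Follows b σ f ∧ ∀ k, ¬ (Even k ↔ b) → f k = h k := by
  classical
  let v : N × N → N := fun p => if (Even p.1 ↔ b) then σ p.2 else h p.1
  have hv : IsDef S v := by fun_prop
  obtain ⟨c, hc, hc0, hcs⟩ := IsDef.exists_rec' (S := S) (emp : N)
    (g := fun p => ins p.2 (pr p.1 (v p))) (by fun_prop)
  let f : N → N := fun t => v (t, c t)
  have hf : IsDef S f := by fun_prop
  have key : ∀ t, icode f t = c t := by
    refine IsDef.induction (S := S) (by fun_prop) (by rw [icode_zero, hc0]) ?_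
    intro t ih
    rw [icode_succ hf, hcs, ih]
  refine ⟨f, hf, ?_, ?_⟩
  · intro k hk
    simp only [f, v, hk, if_true]
    rw [← key k]
  · intro k hk
    simp only [f, v, hk, if_false]

/-- Plays of the same strategy agree as long as the opponent's moves do. -/
theorem Follows.agree {b : Prop} {σ f g : N → N} (hf : IsDef S f) (hg : IsDef S g)
    (hff : Follows b σ f) (hgf : Follows b σ g) {T : N}
    (h : ∀ k, k < T → ¬ (Even k ↔ b) → f k = g k) : ∀ k, k < T → f k = g k := by
  have key : ∀ t, t ≤ T → ∀ k, k < t → f k = g k := by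
    refine IsDef.induction (S := S) (by fun_prop) (fun _ k hk => absurd hk not_lt_zero) ?_
    intro t ih ht k hk
    rcases (lt_succ_iff.mp hk).lt_or_eq with hlt | rfl
    · exact ih (le_trans le_self_add ht) k hlt
    · by_cases hb : Even k ↔ b
      · rw [hff k hb, hgf k hb, icode_congr (ih (le_trans le_self_add ht))]
      · exact h k (succ_le_iff'.mp ht) hb
  exact key T le_rfl

/-- Two positions, reached in plays of the same strategy at times of different parity, can be
continued by playing the strategy against itself: the continuations are equal. -/
theorem exists_mirror {b : Prop} {σ f g : N → N} (hσ : IsDef S σ) (hf : IsDef S f)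
    (hg : IsDef S g) (hff : Follows b σ f) (hgf : Follows b σ g) {s t : N}
    (hst : Even s ↔ ¬ Even t) :
    ∃ f' g' : N → N, IsDef S f' ∧ IsDef S g' ∧ Follows b σ f' ∧ Follows b σ g' ∧
      (∀ k, k < s → f' k = f k) ∧ (∀ k, k < t → g' k = g k) ∧ ∀ k, f' (s + k) = g' (t + k) := by
  classical
  let u : N × N × N → N := fun p => if (Even (s + p.1) ↔ b) then σ p.2.1 else σ p.2.2
  have hu : IsDef S u := by fun_prop
  obtain ⟨c, hc, hc0, hcs⟩ := IsDef.exists_rec' (S := S) (icode f s, icode g t)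
    (g := fun p => (ins p.2.1 (pr (s + p.1) (u p)), ins p.2.2 (pr (t + p.1) (u p)))) (by fun_prop)
  let w : N → N := fun k => u (k, c k)
  have hw : IsDef S w := by fun_prop
  -- the sequence which follows `f` below `s` and continues with `w`
  let ext : (N → N) → N → N → N := fun f s k => if k < s then f k else w (least fun l => k = s + l)
  have hext : ∀ {f : N → N}, IsDef S f → ∀ s, IsDef S (ext f s) := by
    intro f hf s
    simp only [ext]
    fun_prop
  have hlt : ∀ (f : N → N) {s k : N}, k < s → ext f s k = f k := by
    intro f s k hk
    simp only [ext, hk, if_true]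
  have hge : ∀ (f : N → N) (s k : N), ext f s (s + k) = w k := by
    intro f s k
    have h1 : ¬ s + k < s := not_lt.mpr le_self_add
    have h2 : (least fun l => s + k = s + l) = k := by
      have := (IsDef.least_spec (S := S) (P := fun l => s + k = s + l) (by fun_prop) rfl).1
      exact (add_left_cancel this).symm
    simp only [ext, h1, if_false, h2]
  have hc1 : ∀ k, icode (ext f s) (s + k) = (c k).1 := by
    refine IsDef.induction (S := S) ?_ ?_ ?_
    · have := hext hf s
      fun_prop
    · rw [hc0, add_zero]
      exact icode_congr fun i hi => hlt f hi
    · intro k ih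
      rw [← add_assoc, icode_succ (hext hf s), ih, hge, hcs]
  have hc2 : ∀ k, icode (ext g t) (t + k) = (c k).2 := by
    refine IsDef.induction (S := S) ?_ ?_ ?_
    · have := hext hg t
      fun_prop
    · rw [hc0, add_zero]
      exact icode_congr fun i hi => hlt g hi
    · intro k ih
      rw [← add_assoc, icode_succ (hext hg t), ih, hge, hcs]
  refine ⟨ext f s, ext g t, hext hf s, hext hg t, ?_, ?_, fun k hk => hlt f hk,
    fun k hk => hlt g hk,
    fun k => by rw [hge, hge]⟩
  · intro k hk
    rcases lt_or_ge k s with h | h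
    · rw [hlt f h, icode_congr fun i hi => hlt f (hi.trans h), hff k hk]
    · obtain ⟨l, rfl⟩ := exists_add_of_le h
      rw [hge, hc1]
      simp only [w, u, hk, if_true]
  · intro k hk
    rcases lt_or_ge k t with h | h
    · rw [hlt g h, icode_congr fun i hi => hlt g (hi.trans h), hgf k hk]
    · obtain ⟨l, rfl⟩ := exists_add_of_le h
      rw [hge, hc2]
      have : ¬ (Even (s + l) ↔ b) := by
        rw [even_add' S] at hk ⊢
        tauto
      simp only [w, u, this, if_false]

/-- A nonincreasing sequence is eventually equal to its minimum. -/
theorem exists_minEven_iff {r : N → N} (hr : IsDef S r) (h : ∀ t, r (t + 1) ≤ r t) :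
    ∃ T, ∀ t, T ≤ t → (MinEven r ↔ Even (r t)) := by
  obtain ⟨y, ⟨T, rfl⟩, hT⟩ := IsDef.exists_least (S := S) (P := fun y => ∃ t, r t = y)
    (by fun_prop) ⟨0, rfl⟩
  have hmin : ∀ t, r T ≤ r t := fun t => not_lt.mp fun hlt => hT _ hlt ⟨t, rfl⟩
  have hmono : ∀ k, r (T + k) ≤ r T := by
    refine IsDef.induction (S := S) (by fun_prop) (by rw [add_zero]) ?_
    intro k ih
    rw [← add_assoc]
    exact (h _).trans ih
  refine ⟨T, fun t ht => ?_⟩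
  obtain ⟨k, rfl⟩ := exists_add_of_le ht
  rw [le_antisymm (hmono k) (hmin _)]
  constructor
  · rintro ⟨t, h1, h2⟩
    rwa [← le_antisymm (h2 T) (hmin t)]
  · exact fun h1 => ⟨T, h1, hmin⟩

end

/-! ### The game deciding an iterated jump -/

section
variable {N : Type u} [DOSemiring N]

/-- Left inverse of the pairing, first component. -/
noncomputable def lft (p : N) : N := least fun i => ∃ j, p = pr i j

/-- Left inverse of the pairing, second component. -/
noncomputable def rgt (p : N) : N := least fun j => ∃ i, p = pr i j

/-- The predecessor, with value `0` at `0`. -/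
noncomputable def pd (a : N) : N := least fun b => a = b + 1

theorem lft_pr (S : Set (Set N)) [IsACA S] (i j : N) : lft (pr i j) = i := by
  have := (IsDef.least_spec (S := S) (P := fun i' => ∃ j', pr i j = pr i' j') (by fun_prop)
    ⟨j, rfl⟩).1
  obtain ⟨j', h⟩ := this
  exact (pr_inj h).1.symm

theorem rgt_pr (S : Set (Set N)) [IsACA S] (i j : N) : rgt (pr i j) = j := by
  have := (IsDef.least_spec (S := S) (P := fun j' => ∃ i', pr i j = pr i' j') (by fun_prop)
    ⟨i, rfl⟩).1
  obtain ⟨j', h⟩ := this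
  exact (pr_inj h).2.symm

theorem pd_succ (S : Set (Set N)) [IsACA S] (a : N) : pd (a + 1) = a :=
  (add_right_cancel (IsDef.least_spec (S := S) (P := fun b => a + 1 = b + 1)
    (by fun_prop) rfl).1).symm

variable {S : Set (Set N)} [IsACA S]
variable {Γ : Type*} [Coded S Γ]

@[fun_prop]
protected theorem IsDef.lft {f : Γ → N} (hf : IsDef S f) : IsDef S (fun x => lft (f x)) := by
  unfold SOA.lft; fun_prop

@[fun_prop]
protected theorem IsDef.rgt {f : Γ → N} (hf : IsDef S f) : IsDef S (fun x => rgt (f x)) := by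
  unfold SOA.rgt; fun_prop

@[fun_prop]
protected theorem IsDef.pd {f : Γ → N} (hf : IsDef S f) : IsDef S (fun x => pd (f x)) := by
  unfold SOA.pd; fun_prop

/-- `F` meets the closed condition given by `C`: no four arguments stand in the relation `C` to
their
values. -/
def Obeys (C : (N × N × N × N) × (N × N × N × N) → Prop) (F : N → N) : Prop :=
  ∀ z, ¬ C (z, (F z.1, F z.2.1, F z.2.2.1, F z.2.2.2))

/-- `F` is a path over the set `H`: it obeys `C`, and its zeroth column is (the characteristic
function of) `H`. -/
structure IsPath (C : (N × N × N × N) × (N × N × N × N) → Prop) (H : N → Prop) (F : N → N) :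
    Prop where
  obeys : Obeys C F
  col : ∀ z, F (pr z 0) ≠ 0 ↔ H z

/-- `F` extends the finite function coded by `x`. -/
def Extends (F : N → N) (x : N) : Prop := ∀ i b, InF x (pr i b) → F i = b

variable (N) in
/-- A state of the game: the current claim is that a path over the set of level `lev` extends
`qry`; `one` says that player I makes this claim, and then `seq` codes the first `len` values of the
path named so far, and `viol` says that they are not those of such a path. -/
structure St where
  lev : N
  qry : N
  one : Prop
  seq : N
  len : N
  viol : Prop

/-- The components of a state. -/
def St.toProd (q : St N) : N × N × Prop × N × N × Prop :=
  (q.lev, q.qry, q.one, q.seq, q.len, q.viol)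

/-- The state with given components. -/
def St.ofProd (p : N × N × Prop × N × N × Prop) : St N :=
  ⟨p.1, p.2.1, p.2.2.1, p.2.2.2.1, p.2.2.2.2.1, p.2.2.2.2.2⟩

noncomputable instance : Coded S (St N) where
  enc q := Coded.enc S q.toProd
  enc_injective q q' h := by
    have := Coded.enc_injective h
    cases q; cases q'
    simpa [St.toProd] using this
  range_mem := by
    convert Coded.range_mem (S := S) (Γ := N × N × Prop × N × N × Prop) using 1
    ext a
    exact ⟨fun ⟨q, hq⟩ => ⟨q.toProd, hq⟩, fun ⟨p, hp⟩ => ⟨St.ofProd p, hp⟩⟩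

theorem isDef_toProd : IsDef S (St.toProd : St N → _) := by
  have := IsDef.id (S := S) (Γ := N × N × Prop × N × N × Prop)
  unfold IsDef at *
  convert this using 1
  ext a
  exact ⟨fun ⟨q, hq⟩ => ⟨q.toProd, hq⟩, fun ⟨p, hp⟩ => ⟨St.ofProd p, hp⟩⟩

@[fun_prop]
protected theorem IsDef.lev {f : Γ → St N} (hf : IsDef S f) : IsDef S (fun x => (f x).lev) := by
  have := isDef_toProd.comp hf
  exact this.fst
@[fun_prop]
protected theorem IsDef.qry {f : Γ → St N} (hf : IsDef S f) : IsDef S (fun x => (f x).qry) := by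
  have := isDef_toProd.comp hf
  exact this.snd.fst
@[fun_prop]
protected theorem IsDef.one {f : Γ → St N} (hf : IsDef S f) : IsDef S (fun x => (f x).one) := by
  have := isDef_toProd.comp hf
  exact this.snd.snd.fst
@[fun_prop]
protected theorem IsDef.seq {f : Γ → St N} (hf : IsDef S f) : IsDef S (fun x => (f x).seq) := by
  have := isDef_toProd.comp hf
  exact this.snd.snd.snd.fst
@[fun_prop]
protected theorem IsDef.len {f : Γ → St N} (hf : IsDef S f) : IsDef S (fun x => (f x).len) := by
  have := isDef_toProd.comp hf
  exact this.snd.snd.snd.snd.fst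
@[fun_prop]
protected theorem IsDef.viol {f : Γ → St N} (hf : IsDef S f) : IsDef S (fun x => (f x).viol) := by
  have := isDef_toProd.comp hf
  exact this.snd.snd.snd.snd.snd

@[fun_prop]
protected theorem IsDef.stMk {f1 f2 f4 f5 : Γ → N} {f3 f6 : Γ → Prop} (h1 : IsDef S f1)
    (h2 : IsDef S f2) (h3 : IsDef S f3) (h4 : IsDef S f4) (h5 : IsDef S f5) (h6 : IsDef S f6) :
    IsDef S (fun x => St.mk (f1 x) (f2 x) (f3 x) (f4 x) (f5 x) (f6 x)) :=
  h1.prodMk (h2.prodMk (h3.prodMk (h4.prodMk (h5.prodMk h6))))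

/-- Playing `m` as the next value of the path refutes the claim. -/
def Refutes (A : Set N) (C : (N × N × N × N) × (N × N × N × N) → Prop) (q : St N) (m : N) : Prop :=
  (∃ z w : N × N × N × N, C (z, w) ∧
    InF (ins q.seq (pr q.len m)) (pr z.1 w.1) ∧ InF (ins q.seq (pr q.len m)) (pr z.2.1 w.2.1) ∧
    InF (ins q.seq (pr q.len m)) (pr z.2.2.1 w.2.2.1) ∧
    InF (ins q.seq (pr q.len m)) (pr z.2.2.2 w.2.2.2)) ∨
  (∃ b, InF q.qry (pr q.len b) ∧ m ≠ b) ∨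
  (q.lev = 0 ∧ ∃ z, q.len = pr z 0 ∧ ¬ (m ≠ 0 ↔ z ∈ A))

/-- The move `m` challenges a value that the path has in its zeroth column. -/
def Challenges (q : St N) (m : N) : Prop :=
  q.lev ≠ 0 ∧ ∃ z b, m = z + 1 ∧ InF q.seq (pr (pr z 0) b)

open Classical in
/-- The state after the move `m` at time `t`. At time `0` player I names a claim, and at time `1`
player II accepts it, by the move `0`, or leaves it to player I. From then on the player making the
claim names the values of a path, and the opponent may challenge a value in the zeroth column; this
value `b` at `z` says that `z` belongs to the set of level `lev`, or that it does not, that is, it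
makes or denies a claim of the next lower level. -/
noncomputable def step (n : N) (A : Set N) (C : (N × N × N × N) × (N × N × N × N) → Prop)
    (p : N × St N × N) : St N :=
  if p.1 = 0 then ⟨if rgt p.2.2 ≤ n then rgt p.2.2 else n, lft p.2.2, False, emp, 0, False⟩
  else if p.1 = 1 then ⟨p.2.1.lev, p.2.1.qry, p.2.2 ≠ 0, emp, 0, False⟩
  else if p.2.1.viol then p.2.1
  else if Even p.1 ↔ p.2.1.one then
    ⟨p.2.1.lev, p.2.1.qry, p.2.1.one, ins p.2.1.seq (pr p.2.1.len p.2.2), p.2.1.len + 1,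
      Refutes A C p.2.1 p.2.2⟩
  else if Challenges p.2.1 p.2.2 then
    ⟨pd p.2.1.lev, pd p.2.2, p.2.1.one ↔ val p.2.1.seq (pr (pd p.2.2) 0) ≠ 0, emp, 0, False⟩
  else p.2.1

theorem isDef_step {A : Set N} (hA : A ∈ S) {C : (N × N × N × N) × (N × N × N × N) → Prop}
    (hC : IsDef S C) (n : N) :
    IsDef S (step n A C) := by
  have hA := mem_iff_isDef.mp hA
  unfold step Refutes Challenges
  fun_prop

open Classical in
/-- The rank of a state: lower levels have lower ranks, and an even rank means that player I wins
if no further challenge is made. -/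
noncomputable def rank (q : St N) : N :=
  (1 + 1) * ((1 + 1) * q.lev + (if q.viol then 0 else 1)) + (if q.one ↔ ¬ q.viol then 0 else 1)

theorem isDef_rank : IsDef S (rank : St N → N) := by
  unfold rank; fun_prop

/-- `r f t` is the state after the first `t` moves of the play `f`. -/
structure IsRun (S : Set (Set N)) [IsACA S] (n : N) (A : Set N)
    (C : (N × N × N × N) × (N × N × N × N) → Prop)
    (r : (N → N) → N → St N) : Prop where
  isDef : ∀ f, IsDef S f → IsDef S (r f)
  zero : ∀ f, r f 0 = ⟨n + 1, 0, False, emp, 0, False⟩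
  succ : ∀ f, IsDef S f → ∀ t, r f (t + 1) = step n A C (t, r f t, f t)
  congr : ∀ f g t, (∀ i, i < t → f i = g i) → r f t = r g t

theorem exists_isRun {A : Set N} (hA : A ∈ S) {C : (N × N × N × N) × (N × N × N × N) → Prop}
    (hC : IsDef S C) (n : N) :
    ∃ R : N × N → St N, IsDef S R ∧ IsRun S n A C (fun f t => R (icode f t, t)) := by
  have hstep := isDef_step hA hC n
  have : Nonempty (St N) := ⟨⟨0, 0, False, 0, 0, False⟩⟩
  obtain ⟨R, hR, hR0, hRs⟩ := IsDef.exists_rec (S := S) (Γ := N)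
    (a := fun _ => (⟨n + 1, 0, False, emp, 0, False⟩ : St N))
    (g := fun p => step n A C (p.2.1, p.2.2, val p.1 p.2.1)) (by fun_prop) (by fun_prop)
  refine ⟨R, hR, ?_, fun f => hR0 _, ?_, fun f g t h => by rw [icode_congr h]⟩
  · intro f hf; fun_prop
  · intro f hf t
    have key : ∀ t k l, t ≤ k → t ≤ l → R (icode f k, t) = R (icode f l, t) := by
      refine IsDef.induction (S := S) (by fun_prop) (fun k l _ _ => by rw [hR0, hR0]) ?_
      intro t ih k l hk hl
      rw [hRs, hRs, ih k l (le_self_add.trans hk) (le_self_add.trans hl),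
        val_icode hf (succ_le_iff'.mp hk), val_icode hf (succ_le_iff'.mp hl)]
    rw [hRs, val_icode hf (lt_add_one t), key t (t + 1) t le_self_add le_rfl]

/-- The claim `(j, y)` has just been made, by player I iff `b` holds. -/
noncomputable def fresh (j y : N) (b : Prop) : St N := ⟨j, y, b, emp, 0, False⟩

/-- The state in which the other player makes the claim. -/
def St.flip (q : St N) : St N := { q with one := ¬ q.one }

/-- Times from `2` on belong to the main part of the game. -/
theorem two_le_ne {t : N} (ht : 1 + 1 ≤ t) : t ≠ 0 ∧ t ≠ 1 := by
  constructor
  · rintro rfl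
    exact absurd ht (not_le.mpr (by positivity))
  · rintro rfl
    exact absurd ht (not_le.mpr (lt_add_one 1))

section
variable {n : N} {A : Set N} {C : (N × N × N × N) × (N × N × N × N) → Prop} {t : N} {q : St N}
  {m : N}

theorem step_of_viol (ht : 1 + 1 ≤ t) (hv : q.viol) : step n A C (t, q, m) = q := by
  simp [step, two_le_ne ht, hv]

theorem step_of_name (ht : 1 + 1 ≤ t) (hv : ¬ q.viol) (h : Even t ↔ q.one) :
    step n A C (t, q, m) =
      ⟨q.lev, q.qry, q.one, ins q.seq (pr q.len m), q.len + 1, Refutes A C q m⟩ := by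
  simp [step, two_le_ne ht, hv, h]

theorem step_of_challenge (ht : 1 + 1 ≤ t) (hv : ¬ q.viol) (h : ¬ (Even t ↔ q.one))
    (hc : Challenges q m) : step n A C (t, q, m) =
      fresh (pd q.lev) (pd m) (q.one ↔ val q.seq (pr (pd m) 0) ≠ 0) := by
  simp [step, two_le_ne ht, hv, h, hc, fresh]

theorem step_of_pass (ht : 1 + 1 ≤ t) (h : ¬ (Even t ↔ q.one)) (hc : ¬ Challenges q m) :
    step n A C (t, q, m) = q := by
  simp [step, two_le_ne ht, h, hc]

end

/-- The rules are symmetric: the same move at a time of the other parity has the same effect, with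
the roles of the players exchanged. -/
theorem step_flip {n : N} {A : Set N} {C : (N × N × N × N) × (N × N × N × N) → Prop} {s t : N}
    (hs : 1 + 1 ≤ s) (ht : 1 + 1 ≤ t) (hst : Even s ↔ ¬ Even t) (q : St N) (m : N) :
    step n A C (t, q.flip, m) = (step n A C (s, q, m)).flip := by
  by_cases hv : q.viol
  · rw [step_of_viol hs hv, step_of_viol (q := q.flip) ht hv]
  have hv' : ¬ q.flip.viol := hv
  by_cases h : Even s ↔ q.one
  · have h' : Even t ↔ q.flip.one := by simp only [St.flip]; tauto
    rw [step_of_name hs hv h, step_of_name ht hv' h']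
    rfl
  have h' : ¬ (Even t ↔ q.flip.one) := by simp only [St.flip]; tauto
  by_cases hc : Challenges q m
  · rw [step_of_challenge hs hv h hc, step_of_challenge ht hv' h' hc]
    simp only [St.flip, fresh, St.mk.injEq, true_and, and_true]
    exact propext (by tauto)
  · rw [step_of_pass hs h hc, step_of_pass ht h' hc]

theorem even_rank (S : Set (Set N)) [IsACA S] (q : St N) : Even (rank q) ↔ (q.one ↔ ¬ q.viol) := by
  unfold rank
  have h1 : ∀ a : N, Even ((1 + 1) * a) := fun a => ⟨a, by ring⟩
  rw [even_add' S]
  simp only [h1, true_iff]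
  by_cases h : q.one ↔ ¬ q.viol
  · simp [h]
  · simp only [h, if_false, iff_false]
    have := (even_succ S (0 : N)).not.mpr (by simp)
    simpa using this

theorem rank_le_of_lev_lt {q q' : St N} (h : q.lev + 1 ≤ q'.lev) : rank q ≤ rank q' := by
  classical
  have h1 : rank q ≤ (1 + 1) * ((1 + 1) * q.lev + 1) + 1 := by
    unfold rank; gcongr <;> split_ifs <;> simp
  have h2 : (1 + 1) * ((1 + 1) * (q.lev + 1)) ≤ rank q' := by
    unfold rank
    refine le_trans ?_ le_self_add
    gcongr
    refine le_trans ?_ le_self_add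
    gcongr
  refine h1.trans (le_trans ?_ h2)
  have : (1 + 1) * ((1 + 1) * (q.lev + 1)) = (1 + 1) * ((1 + 1) * q.lev + 1) + 1 + 1 := by ring
  rw [this]
  exact le_self_add

namespace IsRun
variable {n : N} {A : Set N} {C : (N × N × N × N) × (N × N × N × N) → Prop} {r : (N → N) → N → St N}

theorem one_eq (hr : IsRun S n A C r) {f : N → N} (hf : IsDef S f) :
    r f 1 = fresh (if rgt (f 0) ≤ n then rgt (f 0) else n) (lft (f 0)) False := by
  classical
  have := hr.succ f hf 0
  rw [zero_add] at this
  rw [this]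
  simp [step, fresh]

theorem two_eq (hr : IsRun S n A C r) {f : N → N} (hf : IsDef S f) :
    r f (1 + 1) = fresh (if rgt (f 0) ≤ n then rgt (f 0) else n) (lft (f 0)) (f 1 ≠ 0) := by
  classical
  rw [hr.succ f hf 1, hr.one_eq hf]
  simp [step, fresh]

theorem rank_antitone (hr : IsRun S n A C r) {f : N → N} (hf : IsDef S f) (t : N) :
    rank (r f (t + 1)) ≤ rank (r f t) := by
  classical
  rcases eq_zero_or_succ t with rfl | ⟨t, rfl⟩
  · refine rank_le_of_lev_lt ?_
    rw [zero_add, hr.one_eq hf, hr.zero]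
    simp only [fresh]
    gcongr
    split_ifs with h
    · exact h
    · exact le_rfl
  rcases eq_zero_or_succ t with rfl | ⟨t, rfl⟩
  · rw [zero_add, hr.two_eq hf, hr.one_eq hf]
    unfold rank fresh
    simp only [not_false_eq_true, iff_true, if_false]
    gcongr
    split_ifs <;> simp
  · have h2 : (1 + 1 : N) ≤ t + 1 + 1 := by rw [add_assoc]; exact le_add_self
    rw [hr.succ f hf (t + 1 + 1)]
    generalize r f (t + 1 + 1) = q
    unfold step
    simp only [two_le_ne h2, if_false]
    split_ifs with h3 h4 h5
    · exact le_rfl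
    · by_cases h6 : Refutes A C q (f (t + 1 + 1))
      · unfold rank
        simp only [h6, h3, if_true, if_false]
        calc (1 + 1) * ((1 + 1) * q.lev + 0) + (if q.one ↔ ¬ True then 0 else 1)
            ≤ (1 + 1) * ((1 + 1) * q.lev + 0) + 1 := by gcongr; split_ifs <;> simp
          _ ≤ (1 + 1) * ((1 + 1) * q.lev + 0) + 1 + 1 := le_self_add
          _ = (1 + 1) * ((1 + 1) * q.lev + 1) := by ring
          _ ≤ _ := le_self_add
      · unfold rank
        simp only [h6, h3]
        exact le_rfl
    · refine rank_le_of_lev_lt ?_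
      obtain ⟨j, hj⟩ := (eq_zero_or_succ q.lev).resolve_left h5.1
      simp only [hj, pd_succ S, le_refl]
    · exact le_rfl

/-- The winner of a play can be read off the state at any late time. -/
theorem exists_minEven_iff (hr : IsRun S n A C r) {f : N → N} (hf : IsDef S f) :
    ∃ T, ∀ t, T ≤ t → (MinEven (fun t => rank (r f t)) ↔ ((r f t).one ↔ ¬ (r f t).viol)) := by
  have h1 := isDef_rank (S := S)
  have h2 := hr.isDef f hf
  obtain ⟨T, hT⟩ := SOA.exists_minEven_iff (S := S) (r := fun t => rank (r f t)) (by fun_prop)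
    (hr.rank_antitone hf)
  exact ⟨T, fun t ht => by rw [hT t ht, even_rank S]⟩

/-- While the claim is fresh, the opponent has nothing to challenge. -/
theorem exists_turn (hr : IsRun S n A C r) {f : N → N} (hf : IsDef S f) {t : N} (ht : 1 + 1 ≤ t)
    {j y : N} {b : Prop} (h : r f t = fresh j y b) :
    ∃ t', 1 + 1 ≤ t' ∧ (Even t' ↔ b) ∧ r f t' = fresh j y b := by
  by_cases hb : Even t ↔ b
  · exact ⟨t, ht, hb, h⟩
  · refine ⟨t + 1, ht.trans le_self_add, ?_, ?_⟩
    · rw [even_succ S]; tauto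
    · rw [hr.succ f hf, h]
      simp [step, two_le_ne ht, fresh, hb, Challenges, inF_emp S]

end IsRun

/-- The strategy `σ` wins for player I if `b` holds, and for player II if not. -/
def Wins (S : Set (Set N)) [IsACA S] (r : (N → N) → N → St N) (b : Prop) (σ : N → N) : Prop :=
  ∀ f, IsDef S f → Follows b σ f → (MinEven (fun t => rank (r f t)) ↔ b)

section
variable {n : N} {A : Set N} {C : (N × N × N × N) × (N × N × N × N) → Prop} {r : (N → N) → N → St N}

/-- In plays of a winning strategy, the same claim is not made by both players. -/
theorem Wins.consistent (hr : IsRun S n A C r) {b : Prop} {σ : N → N} (hσ : IsDef S σ)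
    (hw : Wins S r b σ) {f g : N → N} (hf : IsDef S f) (hg : IsDef S g) (hff : Follows b σ f)
    (hgf : Follows b σ g) {s t j y : N} {c d : Prop} (hs : 1 + 1 ≤ s) (ht : 1 + 1 ≤ t)
    (hfs : r f s = fresh j y c) (hgt : r g t = fresh j y d) : c ↔ d := by
  by_contra hcd
  obtain ⟨s, hs, hsc, hfs⟩ := hr.exists_turn hf hs hfs
  obtain ⟨t, ht, htd, hgt⟩ := hr.exists_turn hg ht hgt
  have hst : Even s ↔ ¬ Even t := by tauto
  obtain ⟨f', g', hf', hg', hff', hgf', hfe, hge, htail⟩ := exists_mirror hσ hf hg hff hgf hst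
  -- the two continuations run through the same states, with the roles of the players exchanged
  have key : ∀ k, r g' (t + k) = (r f' (s + k)).flip := by
    have h1 := hr.isDef f' hf'
    have h2 := hr.isDef g' hg'
    refine IsDef.induction (S := S) (by unfold St.flip; fun_prop) ?_ ?_
    · rw [add_zero, add_zero, hr.congr g' g t hge, hr.congr f' f s hfe, hfs, hgt]
      unfold fresh St.flip
      congr 1
      exact propext (by tauto)
    · intro k ih
      rw [← add_assoc, ← add_assoc, hr.succ g' hg', hr.succ f' hf', ih, ← htail]
      refine step_flip (hs.trans le_self_add) (ht.trans le_self_add) ?_ _ _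
      rw [even_add' S, even_add' S]
      tauto
  obtain ⟨T, hT⟩ := hr.exists_minEven_iff hf'
  obtain ⟨U, hU⟩ := hr.exists_minEven_iff hg'
  have h1 := hT (s + (T + U)) (le_self_add.trans le_add_self)
  have h2 := hU (t + (T + U)) (le_add_self.trans le_add_self)
  rw [hw f' hf' hff'] at h1
  rw [hw g' hg' hgf', key] at h2
  simp only [St.flip] at h2
  tauto

/-- Player I has no winning strategy: it would win both when player II accepts the first claim and
when player II does not. -/
theorem Wins.not_one (hr : IsRun S n A C r) {b : Prop} {σ : N → N} (hσ : IsDef S σ)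
    (hw : Wins S r b σ) : ¬ b := by
  intro hb
  obtain ⟨f, hf, hff, hf1⟩ := exists_follows (S := S) b hσ (h := fun _ => 0) (by fun_prop)
  obtain ⟨g, hg, hgf, hg1⟩ := exists_follows (S := S) b hσ (h := fun _ => 1) (by fun_prop)
  have hodd : ¬ (Even (1 : N) ↔ b) := by
    have := even_succ S (0 : N)
    simp only [zero_add, Even.zero, not_true_eq_false, iff_false] at this
    tauto
  have h0 : f 0 = g 0 := by
    have : Even (0 : N) ↔ b := by simp [hb]
    rw [hff 0 this, hgf 0 this, icode_zero, icode_zero]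
  have h1 := hr.two_eq hf
  have h2 := hr.two_eq hg
  rw [← h0] at h2
  have := hw.consistent hr hσ hf hg hff hgf le_rfl le_rfl h1 h2
  rw [hf1 1 hodd, hg1 1 hodd] at this
  simp at this

end

end

section
variable {N : Type u} [DOSemiring N] {S : Set (Set N)} [IsACA S]

/-- A function passes the test of the game at all arguments iff it is a path extending the query
(over `A`, for a claim of level `0`). -/
theorem forall_not_refutes_iff {A : Set N} {C : (N × N × N × N) × (N × N × N × N) → Prop}
    {F : N → N} (hF : IsDef S F) {j y : N} {c : Prop} :
    (∀ k, ¬ Refutes A C ⟨j, y, c, icode F k, k, False⟩ (F k)) ↔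
      Obeys C F ∧ Extends F y ∧ (j = 0 → ∀ z, F (pr z 0) ≠ 0 ↔ z ∈ A) := by
  simp only [Refutes, ← icode_succ hF, inF_icode_pr hF, lt_succ_iff, not_or]
  constructor
  · intro h
    refine ⟨?_, ?_, ?_⟩
    · rintro ⟨a, b, c, d⟩ hC
      refine (h (a + b + c + d)).1 ⟨(a, b, c, d), (F a, F b, F c, F d), hC, ⟨?_, rfl⟩, ⟨?_, rfl⟩,
        ⟨?_, rfl⟩, ⟨?_, rfl⟩⟩
      · exact le_self_add.trans (le_self_add.trans le_self_add)
      · exact le_add_self.trans (le_self_add.trans le_self_add)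
      · exact le_add_self.trans le_self_add
      · exact le_add_self
    · intro i b hb
      by_contra hne
      exact (h i).2.1 ⟨b, hb, hne⟩
    · intro hj z
      by_contra hne
      exact (h (pr z 0)).2.2 ⟨hj, z, rfl, hne⟩
  · rintro ⟨h1, h2, h3⟩ k
    refine ⟨?_, ?_, ?_⟩
    · rintro ⟨⟨a, b, c, d⟩, ⟨a', b', c', d'⟩, hC, ⟨-, ha⟩, ⟨-, hb⟩, ⟨-, hc⟩, ⟨-, hd⟩⟩
      dsimp only at ha hb hc hd
      subst ha hb hc hd
      exact h1 _ hC
    · rintro ⟨b, hb, hne⟩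
      exact hne (h2 k b hb)
    · rintro ⟨hj, z, rfl, hne⟩
      exact hne (h3 hj z)

set_option maxHeartbeats 800000 in
/-- The finite iterations of the operator taking `H` to the set of (codes of) finite sequences
which are extended by paths over `H` exist, up to any number `n` of the model. -/
theorem exists_jump_hierarchy (hS : S.Nonempty) (hdet : AllSigma01DiffDet (toL2 S hS)) {A : Set N}
    (hA : A ∈ S) {C : (N × N × N × N) × (N × N × N × N) → Prop} (hC : IsDef S C) (n : N) :
    ∃ H : N × N → Prop, IsDef S H ∧ (∀ z, H (0, z) ↔ z ∈ A) ∧ ∀ j, j ≤ n → ∀ y,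
      (H (j + 1, y) ↔ ∃ F, IsDef S F ∧ IsPath C (fun z => H (j, z)) F ∧ Extends F y) := by
  classical
  obtain ⟨R, hR, hr⟩ := exists_isRun hA hC n
  generalize hrdef : (fun (f : N → N) t => R (icode f t, t)) = r at hr
  have hrank := isDef_rank (S := S)
  obtain ⟨b, σ, hσ, hw⟩ := exists_winning_strategy hS hdet (ρ := fun p => rank (R p)) (by fun_prop)
  replace hw : Wins S r b σ := by subst hrdef; exact hw
  have hb : ¬ b := hw.not_one hr hσ
  have even_iff : ∀ k : N, (Even k ↔ b) ↔ ¬ Even k := by intro k; tauto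
  have even1 : ¬ Even (1 : N) := by
    have := even_succ S (0 : N)
    simpa using this
  have even2 : ∀ k : N, Even ((1 + 1) * k + (1 + 1)) := fun k => ⟨k + 1, by ring⟩
  have le2 : ∀ k : N, 1 + 1 ≤ (1 + 1) * k + (1 + 1) := fun k => le_add_self
  -- the answer of player II to the question whether `y` belongs to the set of level `j + 1`
  let ans : N × N → N := fun p => σ (ins emp (pr 0 (pr p.2 p.1)))
  let H : N × N → Prop := fun p => (p.1 = 0 ∧ p.2 ∈ A) ∨ ∃ j, p.1 = j + 1 ∧ ans (j, p.2) = 0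
  have hA' := mem_iff_isDef.mp hA
  have hHs : ∀ j y, H (j + 1, y) ↔ ans (j, y) = 0 := by
    intro j y
    constructor
    · rintro (⟨h, -⟩ | ⟨j', h, h'⟩)
      · exact absurd h (zero_lt_succ j).ne'
      · rwa [add_right_cancel h]
    · exact fun h => Or.inr ⟨j, rfl, h⟩
  have start : ∀ f, IsDef S f → Follows b σ f → ∀ j y, j ≤ n → f 0 = pr y j →
      f 1 = ans (j, y) ∧ r f (1 + 1) = fresh j y (¬ H (j + 1, y)) := by
    intro f hf hff j y hj h0
    have h1 : f 1 = ans (j, y) := by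
      rw [hff 1 ((even_iff 1).mpr even1)]
      have : icode f 1 = ins (icode f 0) (pr 0 (f 0)) := by rw [← icode_succ hf, zero_add]
      rw [this, icode_zero, h0]
    refine ⟨h1, ?_⟩
    rw [hr.two_eq hf, h0, rgt_pr S, lft_pr S, if_pos hj, h1]
    congr 1
    exact propext (not_congr (hHs j y).symm)
  -- in every play player II makes exactly the true claims, as far as `H` is concerned
  have truth : ∀ f, IsDef S f → Follows b σ f → ∀ t j y c, j ≤ n → 1 + 1 ≤ t →
      r f t = fresh j y c → (c ↔ ¬ H (j + 1, y)) := by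
    intro f hf hff t j y c hj ht hft
    obtain ⟨g, hg, hgf, hg1⟩ := exists_follows (S := S) b hσ (h := fun _ => pr y j) (by fun_prop)
    have h0 : g 0 = pr y j := hg1 0 (by simp [hb])
    exact hw.consistent hr hσ hf hg hff hgf ht le_rfl hft (start g hg hgf j y hj h0).2
  refine ⟨H, by fun_prop, ?_, ?_⟩
  · intro z
    constructor
    · rintro (⟨-, h⟩ | ⟨j, h, -⟩)
      · exact h
      · exact absurd h (zero_lt_succ j).ne
    · exact fun h => Or.inl ⟨rfl, h⟩
  intro j hj y
  constructor
  · intro hH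
    -- player I does not challenge anything, and player II names a path
    obtain ⟨f, hf, hff, hf1⟩ := exists_follows (S := S) b hσ
      (h := fun t => if t = 0 then pr y j else 0) (by fun_prop)
    have hf0 : f 0 = pr y j := by rw [hf1 0 (by simp [hb])]; simp
    have hf2 : ∀ k, f ((1 + 1) * k + (1 + 1)) = 0 := by
      intro k
      rw [hf1 _ (by rw [even_iff]; exact not_not.mpr (even2 k))]
      simp
    let F : N → N := fun k => f ((1 + 1) * k + (1 + 1) + 1)
    have hF : IsDef S F := by fun_prop
    have hrf := hr.isDef f hf
    have hviol : ∀ t, 1 + 1 ≤ t → (r f t).viol → ∀ k, (r f (t + k)).viol := by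
      intro t ht hv
      refine IsDef.induction (S := S) (by fun_prop) (by rwa [add_zero]) ?_
      intro k ih
      rw [← add_assoc, hr.succ f hf, step_of_viol (ht.trans le_self_add) ih]
      exact ih
    have state : ∀ k, (r f ((1 + 1) * k + (1 + 1) + 1)).one = False ∧
        (¬ (r f ((1 + 1) * k + (1 + 1) + 1)).viol →
          r f ((1 + 1) * k + (1 + 1) + 1) = ⟨j, y, False, icode F k, k, False⟩) := by
      have pass : ∀ k q, r f ((1 + 1) * k + (1 + 1)) = q → q.one = False →
          r f ((1 + 1) * k + (1 + 1) + 1) = q := by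
        intro k q hq hone
        rw [hr.succ f hf, hq, hf2]
        refine step_of_pass (le2 k) (by simp [hone, even2 k]) ?_
        rintro ⟨-, z, b, h, -⟩
        exact absurd h (zero_lt_succ z).ne
      refine IsDef.induction (S := S) (by fun_prop) ?_ ?_
      · have h2 := (start f hf hff j y hj hf0).2
        have : r f ((1 + 1) * 0 + (1 + 1)) = fresh j y False := by
          rw [mul_zero, zero_add, h2]
          congr 1
          simp [hH]
        rw [pass 0 _ this rfl]
        exact ⟨rfl, fun _ => by rw [icode_zero]; rfl⟩
      · rintro k ⟨hone, hst⟩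
        have e : (1 + 1) * (k + 1) + (1 + 1) = (1 + 1) * k + (1 + 1) + 1 + 1 := by ring
        have le3 : (1 + 1 : N) ≤ (1 + 1) * k + (1 + 1) + 1 := (le2 k).trans le_self_add
        by_cases hv : (r f ((1 + 1) * k + (1 + 1) + 1)).viol
        · have h1 : r f ((1 + 1) * (k + 1) + (1 + 1)) = r f ((1 + 1) * k + (1 + 1) + 1) := by
            rw [e, hr.succ f hf, step_of_viol le3 hv]
          rw [pass (k + 1) _ h1 hone]
          exact ⟨hone, fun h => absurd hv h⟩
        · have h1 : r f ((1 + 1) * (k + 1) + (1 + 1)) = ⟨j, y, False, icode F (k + 1), k + 1,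
              Refutes A C ⟨j, y, False, icode F k, k, False⟩ (F k)⟩ := by
            rw [e, hr.succ f hf, hst hv, step_of_name le3 (fun h => h)
              (by rw [even_succ S]; simp [even2 k])]
            rw [icode_succ hF]
          rw [pass (k + 1) _ h1 rfl]
          exact ⟨rfl, fun h => by simp only [St.mk.injEq, true_and]; exact eq_false h⟩
    have noviol : ∀ t, 1 + 1 ≤ t → ¬ (r f t).viol := by
      intro t ht hv
      obtain ⟨T, hT⟩ := hr.exists_minEven_iff hf
      have h1 := hT ((1 + 1) * (t + T) + (1 + 1) + 1) (by
        have : (1 + 1) * (t + T) + (1 + 1) + 1 = (t + T + t + 1 + 1 + 1) + T := by ring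
        rw [this]; exact le_add_self)
      have h2 := hviol t ht hv (t + T + T + 1 + 1 + 1)
      have e : t + (t + T + T + 1 + 1 + 1) = (1 + 1) * (t + T) + (1 + 1) + 1 := by ring
      rw [e] at h2
      rw [hw f hf hff, (state _).1] at h1
      simp only [h2, not_true_eq_false, iff_true] at h1
      exact hb h1
    have state' : ∀ k, r f ((1 + 1) * k + (1 + 1) + 1) = ⟨j, y, False, icode F k, k, False⟩ :=
      fun k => (state k).2 (noviol _ ((le2 k).trans le_self_add))
    have named : ∀ k, r f ((1 + 1) * (k + 1) + (1 + 1)) = ⟨j, y, False, icode F (k + 1), k + 1,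
        Refutes A C ⟨j, y, False, icode F k, k, False⟩ (F k)⟩ := by
      intro k
      have e : (1 + 1) * (k + 1) + (1 + 1) = (1 + 1) * k + (1 + 1) + 1 + 1 := by ring
      rw [e, hr.succ f hf, state', step_of_name ((le2 k).trans le_self_add) (fun h => h)
        (by rw [even_succ S]; simp [even2 k]), icode_succ hF]
    have hnot : ∀ k, ¬ Refutes A C ⟨j, y, False, icode F k, k, False⟩ (F k) := by
      intro k h
      refine noviol _ (le2 (k + 1)) ?_
      rw [named k]
      exact h
    obtain ⟨h1, h2, h3⟩ := (forall_not_refutes_iff hF).mp hnot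
    refine ⟨F, hF, ⟨h1, fun z => ?_⟩, h2⟩
    rcases eq_zero_or_succ j with rfl | ⟨j, rfl⟩
    · rw [h3 rfl z]
      constructor
      · exact fun h => Or.inl ⟨rfl, h⟩
      · rintro (⟨-, h⟩ | ⟨j, h, -⟩)
        · exact h
        · exact absurd h (zero_lt_succ j).ne
    · -- player I challenges the value at `z` as soon as it is named
      obtain ⟨g, hg, hgf, hg1⟩ := exists_follows (S := S) b hσ
        (h := fun t => if t = 0 then pr y (j + 1) else
          if t = (1 + 1) * (pr z 0 + 1) + (1 + 1) then z + 1 else 0) (by fun_prop)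
      set τ := (1 + 1) * (pr z 0 + 1) + (1 + 1) with hτ
      have hτ0 : τ ≠ 0 := (two_le_ne (le2 _)).1
      have hgτ : g τ = z + 1 := by
        rw [hg1 τ (by rw [even_iff]; exact not_not.mpr (even2 _))]
        simp [hτ0]
      have hagree : ∀ k, k < τ → g k = f k := by
        refine Follows.agree (S := S) hg hf hgf hff fun k hk hkb => ?_
        rw [hg1 k hkb, hf1 k hkb]
        simp [hk.ne]
      have hstate := hr.congr g f τ hagree
      rw [named] at hstate
      have hch : Challenges (⟨j + 1, y, False, icode F (pr z 0 + 1), pr z 0 + 1,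
          Refutes A C ⟨j + 1, y, False, icode F (pr z 0), pr z 0, False⟩ (F (pr z 0))⟩ : St N)
          (z + 1) :=
        ⟨(zero_lt_succ j).ne', z, F (pr z 0), rfl, (inF_icode_pr hF).mpr ⟨lt_add_one _, rfl⟩⟩
      have h4 : r g (τ + 1) = fresh j z (False ↔ F (pr z 0) ≠ 0) := by
        rw [hr.succ g hg, hstate, hgτ, step_of_challenge (le2 _) (hnot _) (by simp [even2]) hch,
          pd_succ S, pd_succ S, val_icode hF (lt_add_one _)]
      have := truth g hg hgf _ j z _ (le_self_add.trans hj) ((le2 _).trans le_self_add) h4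
      rwa [false_iff, not_iff_not] at this
  · rintro ⟨F, hF, hpath, hext⟩
    by_contra hH
    -- player I names the path `F`
    obtain ⟨f, hf, hff, hf1⟩ := exists_follows (S := S) b hσ
      (h := fun t => if t = 0 then pr y j else F (least fun k => t = (1 + 1) * k + (1 + 1)))
      (by fun_prop)
    have hf0 : f 0 = pr y j := by rw [hf1 0 (by simp [hb])]; simp
    have hf2 : ∀ k, f ((1 + 1) * k + (1 + 1)) = F k := by
      intro k
      rw [hf1 _ (by rw [even_iff]; exact not_not.mpr (even2 k)), if_neg (two_le_ne (le2 k)).1]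
      have := (IsDef.least_spec (S := S)
        (P := fun l => (1 + 1) * k + (1 + 1) = (1 + 1) * l + (1 + 1)) (by fun_prop) rfl).1
      have h2 : (0 : N) < 1 + 1 := zero_lt_succ 1
      rw [← mul_left_cancel₀ h2.ne' (add_right_cancel this)]
    have hnot : ∀ k, ¬ Refutes A C ⟨j, y, True, icode F k, k, False⟩ (F k) := by
      refine (forall_not_refutes_iff hF).mpr ⟨hpath.obeys, hext, ?_⟩
      rintro rfl z
      rw [hpath.col z]
      constructor
      · rintro (⟨-, h⟩ | ⟨j, h, -⟩)
        · exact h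
        · exact absurd h (zero_lt_succ j).ne
      · exact fun h => Or.inl ⟨rfl, h⟩
    have hrf := hr.isDef f hf
    have state : ∀ k, r f ((1 + 1) * k + (1 + 1)) = ⟨j, y, True, icode F k, k, False⟩ := by
      refine IsDef.induction (S := S) (by fun_prop) ?_ ?_
      · rw [mul_zero, zero_add, (start f hf hff j y hj hf0).2, icode_zero]
        unfold fresh
        congr 1
        exact eq_true hH
      · intro k ih
        have e : (1 + 1) * (k + 1) + (1 + 1) = (1 + 1) * k + (1 + 1) + 1 + 1 := by ring
        have le3 : (1 + 1 : N) ≤ (1 + 1) * k + (1 + 1) + 1 := (le2 k).trans le_self_add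
        have h1 : r f ((1 + 1) * k + (1 + 1) + 1) =
            ⟨j, y, True, icode F (k + 1), k + 1, False⟩ := by
          rw [hr.succ f hf, ih, hf2, step_of_name (le2 k) (fun h => h) (by simp [even2 k]),
            icode_succ hF]
          congr 1
          exact eq_false (hnot k)
        have hodd : ¬ (Even ((1 + 1) * k + (1 + 1) + 1) ↔ True) := by
          rw [even_succ S]; simp [even2 k]
        have h2 := hr.succ f hf ((1 + 1) * k + (1 + 1) + 1)
        rw [← e, h1] at h2
        by_cases hch : Challenges (⟨j, y, True, icode F (k + 1), k + 1, False⟩ : St N)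
            (f ((1 + 1) * k + (1 + 1) + 1))
        · exfalso
          rw [step_of_challenge le3 (fun h => h) hodd hch] at h2
          obtain ⟨hj0, z, b', hz, hzb⟩ := hch
          obtain ⟨j, rfl⟩ := (eq_zero_or_succ j).resolve_left hj0
          have h3 := (inF_icode_pr hF).mp hzb
          rw [hz, pd_succ S] at h2
          dsimp only at h2
          rw [pd_succ S, val_icode hF h3.1] at h2
          have := truth f hf hff _ j z _ (le_self_add.trans hj) (le2 _) h2
          rw [true_iff, hpath.col z] at this
          exact iff_not_self this
        · rw [h2, step_of_pass le3 hodd hch]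
    obtain ⟨T, hT⟩ := hr.exists_minEven_iff hf
    have h1 := hT ((1 + 1) * T + (1 + 1)) (by
      have : (1 + 1) * T + (1 + 1) = (T + 1 + 1) + T := by ring
      rw [this]; exact le_add_self)
    rw [hw f hf hff, state] at h1
    simp only [not_false_eq_true, iff_true] at h1
    exact hb h1

end

/-! ### Leftmost paths -/

section
variable {N : Type u} [DOSemiring N] {S : Set (Set N)} [IsACA S] {Γ : Type*} [Coded S Γ]

/-- `L` is the leftmost path of the tree of finite sequences in `J`. -/
def IsLeftmost (J : N → Prop) (L : N → N) : Prop :=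
  ∀ t, L t = least fun a => J (ins (icode L t) (pr t a))

theorem exists_isLeftmost {J : Γ × N → Prop} (hJ : IsDef S J) :
    ∃ L : Γ × N → N, IsDef S L ∧ ∀ x, IsLeftmost (fun y => J (x, y)) fun t => L (x, t) := by
  let v : Γ × N × N → N := fun p => least fun a => J (p.1, ins p.2.2 (pr p.2.1 a))
  have hv : IsDef S v := by fun_prop
  obtain ⟨c, hc, hc0, hcs⟩ := IsDef.exists_rec (S := S) (Γ := Γ) (a := fun _ => (emp : N))
    (g := fun p => ins p.2.2 (pr p.2.1 (v p))) (by fun_prop) (by fun_prop)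
  let L : Γ × N → N := fun p => v (p.1, p.2, c p)
  have hL : IsDef S L := by fun_prop
  refine ⟨L, hL, fun x => ?_⟩
  have hLx : IsDef S fun t => L (x, t) := by fun_prop
  have key : ∀ t, icode (fun t => L (x, t)) t = c (x, t) := by
    refine IsDef.induction (S := S) (by fun_prop) (by rw [icode_zero, hc0]) ?_
    intro t ih
    rw [icode_succ hLx, hcs, ih]
  intro t
  rw [key t]

theorem IsLeftmost.unique {J : N → Prop} {L L' : N → N} (hL : IsDef S L) (hL' : IsDef S L')
    (h : IsLeftmost J L) (h' : IsLeftmost J L') : L = L' := by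
  have key : ∀ t, icode L t = icode L' t := by
    refine IsDef.induction (S := S) (by fun_prop) (by rw [icode_zero, icode_zero]) ?_
    intro t ih
    rw [icode_succ hL, icode_succ hL', h t, h' t, ih]
  funext t
  rw [h t, h' t, key t]

theorem IsLeftmost.spec {C : (N × N × N × N) × (N × N × N × N) → Prop} {H J : N → Prop} {L : N → N}
    (hL : IsDef S L) (hJd : IsDef S J) (h : IsLeftmost J L)
    (hJ : ∀ y, J y ↔ ∃ F, IsDef S F ∧ IsPath C H F ∧ Extends F y)
    (hne : ∃ F, IsDef S F ∧ IsPath C H F) :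
    IsPath C H L ∧ ∀ F, IsDef S F → IsPath C H F → ∀ p, (∀ q, q < p → F q = L q) → L p ≤ F p := by
  have agree : ∀ {F t}, Extends F (icode L t) → ∀ q, q < t → F q = L q := fun hF q hq =>
    hF q (L q) ((inF_icode_pr hL).mpr ⟨hq, rfl⟩)
  have extend : ∀ {F t}, (∀ q, q < t → F q = L q) → Extends F (ins (icode L t) (pr t (F t))) := by
    intro F t hF i b hi
    rw [inF_ins S, inF_icode_pr hL, pr_eq_iff] at hi
    rcases hi with ⟨h1, rfl⟩ | ⟨rfl, rfl⟩
    · exact hF i h1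
    · rfl
  have key : ∀ t, J (icode L t) := by
    refine IsDef.induction (S := S) (by fun_prop) ?_ ?_
    · obtain ⟨F, hF, hp⟩ := hne
      exact (hJ _).mpr ⟨F, hF, hp, fun i b hi => by
        rw [icode_zero] at hi; exact absurd hi (inF_emp S)⟩
    · intro t ih
      obtain ⟨F, hF, hp, hext⟩ := (hJ _).mp ih
      rw [icode_succ hL, h t]
      exact (IsDef.least_spec (S := S) (P := fun a => J (ins (icode L t) (pr t a))) (by fun_prop)
        (a := F t) ((hJ _).mpr ⟨F, hF, hp, extend (agree hext)⟩)).1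
  have near : ∀ t, ∃ F, IsDef S F ∧ IsPath C H F ∧ ∀ q, q < t → F q = L q := by
    intro t
    obtain ⟨F, hF, hp, hext⟩ := (hJ _).mp (key t)
    exact ⟨F, hF, hp, agree hext⟩
  refine ⟨⟨?_, ?_⟩, ?_⟩
  · rintro ⟨a, b, c, d⟩ hC
    obtain ⟨F, -, hp, hF⟩ := near (a + b + c + d + 1)
    refine hp.obeys (a, b, c, d) ?_
    have h1 := hF a (lt_succ_iff.mpr (le_self_add.trans (le_self_add.trans le_self_add)))
    have h2 := hF b (lt_succ_iff.mpr (le_add_self.trans (le_self_add.trans le_self_add)))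
    have h3 := hF c (lt_succ_iff.mpr (le_add_self.trans le_self_add))
    have h4 := hF d (lt_succ_iff.mpr le_add_self)
    dsimp only at hC ⊢
    rwa [h1, h2, h3, h4]
  · intro z
    obtain ⟨F, -, hp, hF⟩ := near (pr z 0 + 1)
    rw [← hF _ (lt_add_one _)]
    exact hp.col z
  · intro F hF hp p hagree
    rw [h p]
    exact (IsDef.least_spec (S := S) (P := fun a => J (ins (icode L p) (pr p a))) (by fun_prop)
      (a := F p) ((hJ _).mpr ⟨F, hF, hp, extend hagree⟩)).2 _
      ((hJ _).mpr ⟨F, hF, hp, extend hagree⟩)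

/-! ### Programs: systems of equations between columns -/

/-- The place where the acceptance of the program `e` is recorded. It is not in any column. -/
def acc (e : N) : N := pr (e + 1) 0 + 1

theorem acc_ne_pr (e a b : N) : acc e ≠ pr a b := by
  intro h
  unfold acc pr at h
  rcases le_or_gt (a + b) (e + 1) with h1 | h1
  · have h2 : (a + b) * (a + b) + a ≤ (e + 1 + 0) * (e + 1 + 0) + (e + 1) := by
      rw [add_zero]
      gcongr
      exact le_self_add.trans h1
    rw [← h] at h2
    exact absurd h2 (not_le.mpr (lt_add_one _))
  · have h2 : e + 1 + 1 ≤ a + b := succ_le_iff'.mpr h1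
    have h3 : (e + 1 + 1) * (e + 1 + 1) ≤ (a + b) * (a + b) + a :=
      (mul_le_mul' h2 h2).trans le_self_add
    rw [← h] at h3
    have h4 : (e + 1 + 1) * (e + 1 + 1) =
        (e + 1 + 0) * (e + 1 + 0) + (e + 1) + 1 + (e + 1) := by ring
    rw [h4] at h3
    exact absurd h3 (not_le.mpr (lt_add_of_pos_right _ (zero_lt_succ e)))

theorem acc_inj {e e' : N} (h : acc e = acc e') : e = e' :=
  add_right_cancel (pr_inj (add_right_cancel h)).1

theorem lt_acc (e : N) : e < acc e :=
  lt_succ_iff.mpr (le_self_add.trans (left_le_pr (e + 1) 0))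

/-- The code of the finite function coded by `m`, changed to have the value `a` at `x`. -/
noncomputable def upd (m x a : N) : N :=
  codeOf {p | (InF m p ∧ ∃ y b, p = pr y b ∧ y ≠ x) ∨ p = pr x a}

@[fun_prop]
protected theorem IsDef.upd {f g h : Γ → N} (hf : IsDef S f) (hg : IsDef S g) (hh : IsDef S h) :
    IsDef S (fun x => upd (f x) (g x) (h x)) := by
  unfold SOA.upd codeOf
  simp only [Set.mem_ofPred_eq]
  fun_prop

@[fun_prop]
protected theorem IsDef.acc {f : Γ → N} (hf : IsDef S f) : IsDef S (fun x => acc (f x)) := by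
  unfold SOA.acc; fun_prop

open Classical in
theorem val_upd (S : Set (Set N)) [IsACA S] (m x a y : N) :
    val (upd m x a) y = if y = x then a else val m y := by
  have key : ∀ p, InF (upd m x a) p ↔ (InF m p ∧ ∃ y b, p = pr y b ∧ y ≠ x) ∨ p = pr x a := by
    intro p
    refine inF_codeOf (S := S) (A := {p | (InF m p ∧ ∃ y b, p = pr y b ∧ y ≠ x) ∨ p = pr x a})
      (setOf_mem (by fun_prop)) (b := m + pr x a + 1) ?_
    rintro q (⟨h, -⟩ | rfl)
    · exact h.lt.trans_le (by rw [add_assoc]; exact le_self_add)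
    · exact lt_succ_iff.mpr le_add_self
  split_ifs with h
  · subst h
    refine val_eq S ((key _).mpr (Or.inr rfl)) ?_
    intro b hb
    rcases (key _).mp hb with ⟨-, y', b', h1, h2⟩ | h1
    · exact absurd (pr_inj h1).1.symm h2
    · exact (pr_inj h1).2
  · refine val_congr fun b => ?_
    rw [key]
    constructor
    · rintro (⟨h1, -⟩ | h1)
      · exact h1
      · exact absurd (pr_inj h1).1 h
    · exact fun h1 => Or.inl ⟨h1, y, b, rfl, h⟩

/-- The relation required by an instruction with operation `t` and argument `a`, between a value
`x₁` of the new column and values `x₂`, `x₃` of the other columns involved. The operations are: to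
copy an earlier column, to read a variable, addition, multiplication, a constant, equality, order,
membership, the Sheffer stroke, the existential quantifier (the value of the new column is the
successor of a witness), and the assertion that the value at `a` is not zero. -/
def Rel (t a m d x₁ x₂ x₃ : N) : Prop :=
  (t = 0 → x₁ = x₂) ∧ (t = 1 → x₁ = val m a) ∧ (t = 2 → x₁ = x₂ + x₃) ∧ (t = 3 → x₁ = x₂ * x₃) ∧
  (t = 4 → x₁ = a) ∧ (t = 5 → (x₁ ≠ 0 ↔ x₂ = x₃)) ∧ (t = 6 → (x₁ ≠ 0 ↔ x₂ < x₃)) ∧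
  (t = 7 → (x₁ ≠ 0 ↔ x₃ ≠ 0)) ∧ (t = 8 → (x₁ ≠ 0 ↔ ¬ (x₂ ≠ 0 ∧ x₃ ≠ 0))) ∧
  (t = 9 → (x₁ = d + 1 → x₂ ≠ 0) ∧ (x₂ ≠ 0 → x₁ ≠ 0)) ∧ (t = 10 → m = a → x₁ ≠ 0)

open Classical in
/-- The columns `G k` satisfy the instruction `i`, consisting of an operation, the number of the new
column, and two arguments. The column `I` is the one copied by a copying instruction. -/
def Holds (I : N → N) (G : N → N → N) (i : N × N × N × N) : Prop :=
  ∀ m d, ∀ x₂, x₂ = (if i.1 = 0 then I m else if i.1 = 9 then G i.2.2.2 (upd m i.2.2.1 d)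
      else G i.2.2.1 m) →
    Rel i.1 i.2.2.1 m d (G i.2.1 m) x₂ (if i.1 = 7 then G i.2.2.2 x₂ else G i.2.2.2 m)

/-- The code of an instruction. -/
def num (i : N × N × N × N) : N := pr i.1 (pr i.2.1 (pr i.2.2.1 i.2.2.2))

open Classical in
/-- The closed condition on `F` that each accepted program `e` is satisfied by the columns
`pr (acc e) k`, the columns with numbers below `acc e` being available for copying. -/
def progCond : (N × N × N × N) × (N × N × N × N) → Prop := fun w =>
  ∃ e t k a b m d : N, InF e (num (t, k, a, b)) ∧ w.1.1 = acc e ∧ w.2.1 = 0 ∧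
    w.1.2.1 = pr m (pr (acc e) k) ∧
    w.1.2.2.1 = (if t = 0 then pr m a else if t = 9 then pr (upd m a d) (pr (acc e) b)
      else pr m (pr (acc e) a)) ∧
    w.1.2.2.2 = (if t = 7 then pr w.2.2.2.1 (pr (acc e) b) else pr m (pr (acc e) b)) ∧
    ¬ Rel t a m d w.2.2.1 w.2.2.2.1 w.2.2.2.2

theorem isDef_progCond : IsDef S (progCond : (N × N × N × N) × (N × N × N × N) → Prop) := by
  unfold progCond Rel num
  fun_prop

theorem obeys_progCond_iff {F : N → N} : Obeys progCond F ↔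
    ∀ e, F (acc e) = 0 → ∀ i, InF e (num i) →
      Holds (fun m => F (pr m i.2.2.1)) (fun k m => F (pr m (pr (acc e) k))) i := by
  constructor
  · rintro h e he ⟨t, k, a, b⟩ hi m d x₂ rfl
    by_contra hR
    let q := if t = 0 then pr m a else if t = 9 then pr (upd m a d) (pr (acc e) b)
      else pr m (pr (acc e) a)
    refine h (acc e, pr m (pr (acc e) k), q,
      if t = 7 then pr (F q) (pr (acc e) b) else pr m (pr (acc e) b))
      ⟨e, t, k, a, b, m, d, hi, rfl, he, rfl, rfl, rfl, ?_⟩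
    have hq : F q = (if t = 0 then F (pr m a) else if t = 9 then
        F (pr (upd m a d) (pr (acc e) b)) else F (pr m (pr (acc e) a))) := by
      dsimp only [q]; split_ifs <;> rfl
    dsimp only at hR ⊢
    rw [← hq] at hR
    convert hR using 2
    split_ifs <;> rfl
  · rintro h ⟨q0, q1, q2, q3⟩ ⟨e, t, k, a, b, m, d, hi, h0, he, h1, h2, h3, hR⟩
    dsimp only at h0 he h1 h2 h3 hR
    subst h0
    refine hR ?_
    have := h e he (t, k, a, b) hi m d (F q2) (by rw [h2]; dsimp only; split_ifs <;> rfl)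
    dsimp only at this
    convert this using 1
    · rw [h1]
    · rw [h3]; split_ifs <;> rfl

/-- There is a path over any set: reject all programs. -/
theorem exists_isPath {H : N → Prop} (hH : IsDef S H) : ∃ F, IsDef S F ∧ IsPath progCond H F := by
  classical
  refine ⟨fun q => if ∃ z, q = pr z 0 ∧ ¬ H z then 0 else 1, by fun_prop, ?_, ?_⟩
  · rw [obeys_progCond_iff]
    intro e he
    exfalso
    rw [if_neg] at he
    · exact one_ne_zero he
    · rintro ⟨z, h, -⟩
      exact acc_ne_pr _ _ _ h
  · intro z
    split_ifs with h
    · obtain ⟨z', h1, h2⟩ := h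
      rw [(pr_inj h1).1]
      simp [h2]
    · simp only [ne_eq, one_ne_zero, not_false_eq_true, true_iff]
      by_contra hz
      exact h ⟨z, rfl, hz⟩

/-- A program with a solution is accepted by the leftmost path. The reason is that the leftmost path
may be changed to accept the program, to have the solution in the columns reserved for the program,
and to reject all later programs. -/
theorem holds_of_solution {H : N → Prop} {L : N → N} (hL : IsDef S L) (hpath : IsPath progCond H L)
    (hleft : ∀ F, IsDef S F → IsPath progCond H F → ∀ p, (∀ q, q < p → F q = L q) → L p ≤ F p)
    {e : N} {G : N → N → N} (hG : IsDef S (fun p : N × N => G p.1 p.2))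
    (h : ∀ i, InF e (num i) → Holds (fun m => L (pr m i.2.2.1)) G i) :
    ∀ i, InF e (num i) →
      Holds (fun m => L (pr m i.2.2.1)) (fun k m => L (pr m (pr (acc e) k))) i := by
  classical
  set p := acc e with hp
  have arg_lt : ∀ {e : N} {i : N × N × N × N}, InF e (num i) → i.2.2.1 < acc e := by
    intro e i hi
    refine lt_of_le_of_lt ?_ (hi.lt.trans (lt_acc e))
    exact (left_le_pr _ _).trans ((right_le_pr _ _).trans (right_le_pr _ _))
  let F : N → N := fun q => if q = p then 0 else
    if ∃ k m, q = pr m (pr p k) then G (rgt (rgt q)) (lft q) else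
    if p < q ∧ ∃ e', q = acc e' then 1 else L q
  have hF : IsDef S F := by fun_prop
  have hFp : F p = 0 := by simp only [F, if_true]
  have hFG : ∀ k m, F (pr m (pr p k)) = G k m := by
    intro k m
    have h1 : pr m (pr p k) ≠ p := fun h => acc_ne_pr _ _ _ h.symm
    have h2 : ∃ k' m', pr m (pr p k) = pr m' (pr p k') := ⟨k, m, rfl⟩
    simp only [F, h1, h2, if_false, if_true, rgt_pr S, lft_pr S]
  have hFL : ∀ m c, (∀ k, c ≠ pr p k) → F (pr m c) = L (pr m c) := by
    intro m c hc
    have h1 : pr m c ≠ p := fun h => acc_ne_pr _ _ _ h.symm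
    have h2 : ¬ ∃ k' m', pr m c = pr m' (pr p k') := by
      rintro ⟨k', m', h⟩
      exact hc k' (pr_inj h).2
    have h3 : ¬ (p < pr m c ∧ ∃ e', pr m c = acc e') := by
      rintro ⟨-, e', h⟩
      exact acc_ne_pr _ _ _ h.symm
    simp only [F, h1, h2, h3, if_false]
  have hlow : ∀ q, q < p → F q = L q := by
    intro q hq
    have h2 : ¬ ∃ k' m', q = pr m' (pr p k') := by
      rintro ⟨k', m', rfl⟩
      exact absurd ((left_le_pr p k').trans (right_le_pr m' _)) (not_le.mpr hq)
    have h3 : ¬ (p < q ∧ ∃ e', q = acc e') := fun h => absurd h.1 (not_lt.mpr hq.le)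
    simp only [F, hq.ne, h2, h3, if_false]
  have hsmall : ∀ {c}, c < p → ∀ k, c ≠ pr p k := by
    rintro c hc k rfl
    exact absurd (left_le_pr p k) (not_le.mpr hc)
  have hcopy : ∀ c, c < p → (fun m => F (pr m c)) = fun m => L (pr m c) := fun c hc =>
    funext fun m => hFL m c (hsmall hc)
  have hFpath : IsPath progCond H F := by
    refine ⟨?_, fun z => ?_⟩
    · rw [obeys_progCond_iff]
      intro e' he' i hi
      rcases lt_trichotomy (acc e') p with hlt | heq | hgt
      · have h1 : (fun m => F (pr m i.2.2.1)) = fun m => L (pr m i.2.2.1) :=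
          hcopy _ ((arg_lt hi).trans hlt)
        have h2 : (fun k m => F (pr m (pr (acc e') k))) = fun k m => L (pr m (pr (acc e') k)) := by
          funext k m
          refine hFL m _ fun k' h => ?_
          exact hlt.ne (pr_inj h).1
        rw [h1, h2]
        rw [hlow _ hlt] at he'
        exact obeys_progCond_iff.mp hpath.obeys e' he' i hi
      · have := acc_inj heq
        subst this
        rw [hcopy _ (arg_lt hi)]
        simp only [← hp, hFG]
        exact h i hi
      · exfalso
        have h1 : ¬ ∃ k' m', acc e' = pr m' (pr p k') := by
          rintro ⟨k', m', h⟩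
          exact acc_ne_pr _ _ _ h
        have h2 : p < acc e' ∧ ∃ e'', acc e' = acc e'' := ⟨hgt, e', rfl⟩
        simp only [F, hgt.ne', h1, h2, if_false, and_self, if_true, one_ne_zero] at he'
    · rw [hFL z 0 (hsmall (lt_of_le_of_lt zero_le (lt_acc e)))]
      exact hpath.col z
  have hLp : L p = 0 := by
    have := hleft F hF hFpath p hlow
    rw [hFp] at this
    exact le_antisymm this zero_le
  exact obeys_progCond_iff.mp hpath.obeys e hLp

end

/-! ### Programs for arithmetical formulas -/

section
variable {N : Type u} [DOSemiring N] {S : Set (Set N)} [IsACA S]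

/-- The columns `G` satisfy the instructions in `E`, where `O` gives the columns to be copied. -/
def HoldsAll (O G : N → N → N) (E : List (N × N × N × N)) : Prop :=
  ∀ i ∈ E, Holds (O i.2.2.1) G i

/-- There are programs, with columns numbered from any given number, for a column `g` with the
property `Q A g`, where `A` is the set given by column `0`. The program forces its last column `k₁`
to have the property, and can be satisfied whatever the columns before the given number are. -/
def Compiles (S : Set (Set N)) [IsACA S] (O : N → N → N) (Q : Set N → (N → N) → Prop) : Prop :=
  ∀ k₀ : N, 0 < k₀ → ∃ k₁, k₀ ≤ k₁ ∧ ∃ E : List (N × N × N × N),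
    (∀ G, HoldsAll O G E → Q {z | G 0 z ≠ 0} (G k₁)) ∧
    ∀ G : N → N → N, IsDef S (fun p : N × N => G p.1 p.2) → ∃ G' : N → N → N,
      IsDef S (fun p : N × N => G' p.1 p.2) ∧ (∀ k, k < k₀ → G' k = G k) ∧
      ∀ G'', (∀ k, k ≤ k₁ → G'' k = G' k) → HoldsAll O G'' E

namespace Compiles
variable {O : N → N → N} {Q Q₁ Q₂ : Set N → (N → N) → Prop}

theorem trivial : Compiles S O (fun _ _ => True) := fun k₀ _ =>
  ⟨k₀, le_rfl, [], fun _ _ => True.intro, fun G hG => ⟨G, hG, fun _ _ => rfl, fun _ _ i hi => by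
    simp at hi⟩⟩

/-- Composition with a single instruction, which computes a column from the previous result (and
column `0`). -/
theorem extend (h : Compiles S O Q₁) (i : N → N → N × N × N × N) (c : (N → N) → (N → N) → N → N)
    (hc : ∀ g₀ g, IsDef S g₀ → IsDef S g → IsDef S (c g₀ g))
    (hold : ∀ (G : N → N → N) k k₁, IsDef S (G k₁) → G k = c (G 0) (G k₁) →
      Holds (O (i k k₁).2.2.1) G (i k k₁))
    (sound : ∀ (G : N → N → N) k k₁, Holds (O (i k k₁).2.2.1) G (i k k₁) →
      Q₁ {z | G 0 z ≠ 0} (G k₁) → Q {z | G 0 z ≠ 0} (G k)) : Compiles S O Q := by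
  classical
  intro k₀ hk₀
  obtain ⟨k₁, hk₁, E, hE, hG⟩ := h k₀ hk₀
  refine ⟨k₁ + 1, hk₁.trans le_self_add, i (k₁ + 1) k₁ :: E, ?_, ?_⟩
  · intro G hGE
    exact sound G _ k₁ (hGE _ (by simp)) (hE G fun j hj => hGE j (by simp [hj]))
  · intro G hGd
    obtain ⟨G₁, hd, hlow, hup⟩ := hG G hGd
    have hcd := hc (G₁ 0) (G₁ k₁) (by fun_prop) (by fun_prop)
    have ne : ∀ k, k ≤ k₁ → k ≠ k₁ + 1 := fun k hk => (lt_succ_iff.mpr hk).ne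
    refine ⟨fun k m => if k = k₁ + 1 then c (G₁ 0) (G₁ k₁) m else G₁ k m, by fun_prop, ?_, ?_⟩
    · intro k hk
      simp only [ne k (hk.le.trans hk₁), if_false]
      exact hlow k hk
    · intro G'' hG''
      have hold' : ∀ k, k ≤ k₁ → G'' k = G₁ k := by
        intro k hk
        rw [hG'' k (hk.trans le_self_add)]
        simp only [ne k hk, if_false]
      intro j hj
      rcases List.mem_cons.mp hj with rfl | hj
      · refine hold G'' _ _ (by rw [hold' k₁ le_rfl]; fun_prop) ?_
        rw [hG'' _ le_rfl, hold' 0 zero_le, hold' k₁ le_rfl]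
        simp only [if_true]
      · exact hup G'' hold' j hj

/-- Composition with a single instruction, which computes a column from two previous results. -/
theorem binary (h₁ : Compiles S O Q₁) (h₂ : Compiles S O Q₂) (t : N)
    (c : (N → N) → (N → N) → N → N) (hc : ∀ g₀ g, IsDef S g₀ → IsDef S g → IsDef S (c g₀ g))
    (hold : ∀ (I : N → N) (G : N → N → N) k a b, G k = c (G a) (G b) → Holds I G (t, k, a, b))
    (sound : ∀ (I : N → N) (G : N → N → N) A k a b, Holds I G (t, k, a, b) →
      Q₁ A (G a) → Q₂ A (G b) → Q A (G k)) : Compiles S O Q := by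
  classical
  intro k₀ hk₀
  obtain ⟨k₁, hk₁, E₁, hE₁, hG₁⟩ := h₁ k₀ hk₀
  obtain ⟨k₂, hk₂, E₂, hE₂, hG₂⟩ := h₂ (k₁ + 1) (zero_lt_succ _)
  have hk₁₂ : k₁ ≤ k₂ := le_self_add.trans hk₂
  refine ⟨k₂ + 1, (hk₁.trans hk₁₂).trans le_self_add, (t, k₂ + 1, k₁, k₂) :: (E₁ ++ E₂), ?_, ?_⟩
  · intro G hGE
    exact sound _ G _ _ k₁ k₂ (hGE _ (by simp)) (hE₁ G fun j hj => hGE j (by simp [hj]))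
      (hE₂ G fun j hj => hGE j (by simp [hj]))
  · intro G hGd
    obtain ⟨G₁, hd₁, hlow₁, hup₁⟩ := hG₁ G hGd
    obtain ⟨G₂, hd₂, hlow₂, hup₂⟩ := hG₂ G₁ hd₁
    have hcd := hc (G₂ k₁) (G₂ k₂) (by fun_prop) (by fun_prop)
    have ne : ∀ k, k ≤ k₂ → k ≠ k₂ + 1 := fun k hk => (lt_succ_iff.mpr hk).ne
    refine ⟨fun k m => if k = k₂ + 1 then c (G₂ k₁) (G₂ k₂) m else G₂ k m, by fun_prop, ?_, ?_⟩
    · intro k hk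
      have hkk := hk.le.trans hk₁
      simp only [ne k (hkk.trans hk₁₂), if_false]
      rw [← hlow₁ k hk, ← hlow₂ k (lt_succ_iff.mpr hkk)]
    · intro G'' hG''
      have hold' : ∀ k, k ≤ k₂ → G'' k = G₂ k := by
        intro k hk
        rw [hG'' k (hk.trans le_self_add)]
        simp only [ne k hk, if_false]
      intro j hj
      rcases List.mem_cons.mp hj with rfl | hj
      · refine hold _ G'' _ _ _ ?_
        rw [hG'' _ le_rfl, hold' k₁ hk₁₂, hold' k₂ le_rfl]
        simp only [if_true]
      rcases List.mem_append.mp hj with hj | hj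
      · refine hup₁ G'' (fun k hk => ?_) j hj
        rw [hold' k (hk.trans hk₁₂), hlow₂ k (lt_succ_iff.mpr hk)]
      · exact hup₂ G'' hold' j hj

theorem congr (h : Compiles S O Q₁) (hQ : ∀ A g, Q₁ A g → Q A g) : Compiles S O Q := by
  intro k₀ hk₀
  obtain ⟨k₁, hk₁, E, hE, hG⟩ := h k₀ hk₀
  exact ⟨k₁, hk₁, E, fun G hGE => hQ _ _ (hE G hGE), hG⟩

end Compiles

/-- There are programs for the characteristic function of the relation `R`. -/
def CompilesRel (S : Set (Set N)) [IsACA S] (O : N → N → N) (R : Set N → N → Prop) : Prop :=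
  Compiles S O fun A g => ∀ m, g m ≠ 0 ↔ R A m

/-- There are programs for the function `u`. -/
def CompilesFun (S : Set (Set N)) [IsACA S] (O : N → N → N) (u : N → N) : Prop :=
  Compiles S O fun _ g => ∀ m, g m = u m

/-- The values of the variables coded by `m`. -/
noncomputable def asg (m : N) : ℕ → N := fun x => val m (x : N)

theorem asg_upd (S : Set (Set N)) [IsACA S] (m a : N) (x : ℕ) :
    asg (upd m (x : N) a) = Function.update (asg m) x a := by
  classical
  funext y
  unfold asg
  rw [val_upd S, Function.update_apply]
  simp only [Nat.cast_inj]

theorem exists_asg (S : Set (Set N)) [IsACA S] (v : ℕ → N) (B : ℕ) :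
    ∃ m : N, ∀ x, x < B → asg m x = v x := by
  induction B with
  | zero => exact ⟨0, fun x hx => absurd hx (Nat.not_lt_zero x)⟩
  | succ B ih =>
    obtain ⟨m, hm⟩ := ih
    refine ⟨upd m (B : N) (v B), fun x hx => ?_⟩
    rw [asg_upd S]
    rcases Nat.lt_succ_iff_lt_or_eq.mp hx with h | rfl
    · rw [Function.update_of_ne h.ne, hm x h]
    · rw [Function.update_self]

section
variable {O : N → N → N}

theorem CompilesFun.var (x : ℕ) : CompilesFun S O fun m => asg m x := by
  refine Compiles.extend Compiles.trivial (fun k _ => (1, k, (x : N), 0)) (fun _ _ m => val m x)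
    (fun _ _ _ _ => by fun_prop) ?_ ?_
  · intro G k _ _ h m d x₂ _
    simp [Rel, h]
  · intro G k _ h _ m
    have := h m 0 _ rfl
    simpa [Rel, asg] using this

theorem CompilesFun.const (a : N) : CompilesFun S O fun _ => a := by
  refine Compiles.extend Compiles.trivial (fun k _ => (4, k, a, 0)) (fun _ _ _ => a)
    (fun _ _ _ _ => by fun_prop) ?_ ?_
  · intro G k _ _ h m d x₂ _
    simp [Rel, h]
  · intro G k _ h _ m
    have := h m 0 _ rfl
    simpa [Rel] using this

theorem CompilesFun.add {f g : N → N} (hf : CompilesFun S O f) (hg : CompilesFun S O g) :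
    CompilesFun S O fun m => f m + g m := by
  refine Compiles.binary hf hg 2 (fun f g m => f m + g m)
    (fun _ _ _ _ => by fun_prop) ?_ ?_
  · rintro I G k a b h m d x₂ rfl
    simp [Rel, h]
  · intro I G A k a b h h₁ h₂ m
    have := h m 0 _ rfl
    simpa [Rel, h₁ m, h₂ m] using this

theorem CompilesFun.mul {f g : N → N} (hf : CompilesFun S O f) (hg : CompilesFun S O g) :
    CompilesFun S O fun m => f m * g m := by
  refine Compiles.binary hf hg 3 (fun f g m => f m * g m)
    (fun _ _ _ _ => by fun_prop) ?_ ?_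
  · rintro I G k a b h m d x₂ rfl
    simp [Rel, h]
  · intro I G A k a b h h₁ h₂ m
    have := h m 0 _ rfl
    simpa [Rel, h₁ m, h₂ m] using this

open Classical in
theorem CompilesRel.eq {f g : N → N} (hf : CompilesFun S O f) (hg : CompilesFun S O g) :
    CompilesRel S O fun _ m => f m = g m := by
  refine Compiles.binary hf hg 5 (fun f g m => if f m = g m then 1 else 0)
    (fun _ _ _ _ => by fun_prop) ?_ ?_
  · rintro I G k a b h m d x₂ rfl
    simp [Rel, h]
  · intro I G A k a b h h₁ h₂ m
    have := h m 0 _ rfl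
    simpa [Rel, h₁ m, h₂ m] using this

open Classical in
theorem CompilesRel.lt {f g : N → N} (hf : CompilesFun S O f) (hg : CompilesFun S O g) :
    CompilesRel S O fun _ m => f m < g m := by
  refine Compiles.binary hf hg 6 (fun f g m => if f m < g m then 1 else 0)
    (fun _ _ _ _ => by fun_prop) ?_ ?_
  · rintro I G k a b h m d x₂ rfl
    simp [Rel, h]
  · intro I G A k a b h h₁ h₂ m
    have := h m 0 _ rfl
    simpa [Rel, h₁ m, h₂ m] using this

theorem CompilesRel.nand {P Q : Set N → N → Prop} (hP : CompilesRel S O P)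
    (hQ : CompilesRel S O Q) : CompilesRel S O fun A m => ¬ (P A m ∧ Q A m) := by
  classical
  refine Compiles.binary hP hQ 8 (fun f g m => if f m ≠ 0 ∧ g m ≠ 0 then 0 else 1)
    (fun _ _ _ _ => by fun_prop) ?_ ?_
  · rintro I G k a b h m d x₂ rfl
    simp [Rel, h]
  · intro I G A k a b h h₁ h₂ m
    have := h m 0 _ rfl
    dsimp only
    rw [← h₁ m, ← h₂ m]
    simpa [Rel] using this

/-- Membership in the set given by column `0`. -/
theorem CompilesRel.memZero {f : N → N} (hf : CompilesFun S O f) :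
    CompilesRel S O fun A m => f m ∈ A := by
  refine Compiles.extend hf (fun k k₁ => (7, k, k₁, 0)) (fun g₀ g m => g₀ (g m))
    (fun _ _ _ _ => by fun_prop) ?_ ?_
  · rintro G k k₁ - h m d x₂ rfl
    simp [Rel, h]
  · intro G k k₁ h h₁ m
    have := h m 0 _ rfl
    simpa [Rel, h₁ m] using this

/-- Membership in the set given by a column that is available for copying. -/
theorem CompilesRel.memOld {f : N → N} (hf : CompilesFun S O f) (c : N) (hO : IsDef S (O c)) :
    CompilesRel S O fun _ m => O c (f m) ≠ 0 := by
  have h : Compiles S O fun _ g => ∀ m, g m = O c m := by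
    refine Compiles.extend Compiles.trivial (fun k _ => (0, k, c, 0)) (fun _ _ m => O c m)
      (fun _ _ _ _ => by fun_prop) ?_ ?_
    · rintro G k _ _ h m d x₂ rfl
      simp [Rel, h]
    · intro G k _ h _ m
      have := h m 0 _ rfl
      simpa [Rel] using this
  refine Compiles.binary hf h 7 (fun f g m => g (f m))
    (fun _ _ _ _ => by fun_prop) ?_ ?_
  · rintro I G k a b h m d x₂ rfl
    simp [Rel, h]
  · intro I G A k a b h h₁ h₂ m
    have := h m 0 _ rfl
    simpa [Rel, h₁ m, h₂ (f m)] using this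

theorem CompilesRel.exists {P : Set N → N → Prop} (hP : CompilesRel S O P) (x : ℕ) :
    CompilesRel S O fun A m => ∃ a, P A (upd m x a) := by
  classical
  refine Compiles.extend hP (fun k k₁ => (9, k, (x : N), k₁))
    (fun _ g m => if ∃ a, g (upd m x a) ≠ 0 then (least fun a => g (upd m x a) ≠ 0) + 1 else 0)
    (fun _ _ _ _ => by fun_prop) ?_ ?_
  · rintro G k k₁ hd h m d x₂ rfl
    have hd' : IsDef S fun a => G k₁ (upd m x a) ≠ 0 := by fun_prop
    have hs : ∀ a, G k₁ (upd m x a) ≠ 0 →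
        G k₁ (upd m x (least fun a => G k₁ (upd m x a) ≠ 0)) ≠ 0 :=
      fun a ha => (IsDef.least_spec hd' ha).1
    simp [Rel, h]
    refine ⟨fun h1 => ?_, fun h1 => ⟨d, h1⟩⟩
    split_ifs at h1 with hex
    · obtain ⟨a, ha⟩ := hex
      rw [← add_right_cancel h1]
      exact hs a ha
    · exact absurd h1 (zero_lt_succ d).ne
  · intro G k k₁ h h₁ m
    have key := fun d => h m d _ rfl
    simp [Rel] at key
    simp only [← h₁]
    constructor
    · intro hm
      obtain ⟨d, hd⟩ := (eq_zero_or_succ _).resolve_left hm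
      exact ⟨d, (key d).1 hd⟩
    · rintro ⟨d, hd⟩
      exact (key d).2 hd

theorem CompilesRel.congr {P Q : Set N → N → Prop} (hP : CompilesRel S O P)
    (h : ∀ A m, P A m ↔ Q A m) : CompilesRel S O Q :=
  Compiles.congr hP fun A g hg m => by rw [hg m, h A m]

theorem CompilesRel.not {P : Set N → N → Prop} (hP : CompilesRel S O P) :
    CompilesRel S O fun A m => ¬ P A m :=
  (hP.nand hP).congr fun A m => by simp

theorem CompilesRel.and {P Q : Set N → N → Prop} (hP : CompilesRel S O P)
    (hQ : CompilesRel S O Q) : CompilesRel S O fun A m => P A m ∧ Q A m :=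
  (hP.nand hQ).not.congr fun A m => by simp

theorem compilesFun_term (t : Term) : CompilesFun S O fun m => tv t (asg m) := by
  induction t with
  | var x => exact CompilesFun.var x
  | zero => exact CompilesFun.const 0
  | one => exact CompilesFun.const 1
  | add s t hs ht => exact hs.add ht
  | mul s t hs ht => exact hs.mul ht

/-- There are programs for arithmetical formulas, with a set variable `X` standing for the set given
by column `0`, and the other set variables for sets given by columns available for copying. -/
theorem compilesRel_formula (hO : ∀ c, IsDef S (O c)) (X : ℕ) (c : ℕ → N) (φ : Formula)
    (hφ : IsArithmetical φ) : CompilesRel S O fun A m =>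
      ASat φ (asg m) (Function.update (fun Y => {z | O (c Y) z ≠ 0}) X A) := by
  induction φ with
  | eq s t => exact CompilesRel.eq (compilesFun_term s) (compilesFun_term t)
  | lt s t => exact CompilesRel.lt (compilesFun_term s) (compilesFun_term t)
  | mem t Y =>
    by_cases h : Y = X
    · subst h
      exact (CompilesRel.memZero (compilesFun_term t)).congr fun A m => by simp [ASat]
    · exact (CompilesRel.memOld (compilesFun_term t) (c Y) (hO _)).congr fun A m => by
        simp [ASat, h]
  | not φ ih => exact (ih hφ).not
  | and φ ψ h₁ h₂ => exact (h₁ hφ.1).and (h₂ hφ.2)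
  | or φ ψ h₁ h₂ =>
    exact ((h₁ hφ.1).not.nand (h₂ hφ.2).not).congr fun A m => by
      simp only [ASat]
      tauto
  | imp φ ψ h₁ h₂ =>
    exact ((h₁ hφ.1).nand (h₂ hφ.2).not).congr fun A m => by
      simp only [ASat]
      tauto
  | exN x φ ih =>
    exact ((ih hφ).exists x).congr fun A m => by
      simp only [ASat, asg_upd S]
  | allN x φ ih =>
    exact (((ih hφ).not.exists x).not).congr fun A m => by
      simp only [ASat, asg_upd S, not_exists, not_not]
  | allS => exact hφ.elim
  | exS => exact hφ.elim

end

/-- A formula mentions only finitely many variables. -/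
theorem exists_aSat_congr (φ : Formula) : ∃ B : ℕ, ∀ (v v' : ℕ → N) (V V' : ℕ → Set N),
    (∀ x, x < B → v x = v' x) → (∀ X, X < B → V X = V' X) → (ASat φ v V ↔ ASat φ v' V') := by
  have term : ∀ t : Term, ∃ B : ℕ, ∀ v v' : ℕ → N, (∀ x, x < B → v x = v' x) →
      tv t v = tv t v' := by
    intro t
    induction t with
    | var x => exact ⟨x + 1, fun v v' h => h x (Nat.lt_succ_self x)⟩
    | zero => exact ⟨0, fun _ _ _ => rfl⟩
    | one => exact ⟨0, fun _ _ _ => rfl⟩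
    | add s t hs ht | mul s t hs ht =>
      obtain ⟨B, hB⟩ := hs
      obtain ⟨B', hB'⟩ := ht
      refine ⟨max B B', fun v v' h => ?_⟩
      simp only [tv_add, tv_mul]
      rw [hB v v' fun x hx => h x (lt_max_of_lt_left hx),
        hB' v v' fun x hx => h x (lt_max_of_lt_right hx)]
  induction φ with
  | eq s t | lt s t =>
    obtain ⟨B, hB⟩ := term s
    obtain ⟨B', hB'⟩ := term t
    refine ⟨max B B', fun v v' V V' h _ => ?_⟩
    simp only [ASat]
    rw [hB v v' fun x hx => h x (lt_max_of_lt_left hx),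
        hB' v v' fun x hx => h x (lt_max_of_lt_right hx)]
  | mem t Y =>
    obtain ⟨B, hB⟩ := term t
    refine ⟨max B (Y + 1), fun v v' V V' h hV => ?_⟩
    simp only [ASat]
    rw [hB v v' fun x hx => h x (lt_max_of_lt_left hx),
      hV Y (lt_max_of_lt_right (Nat.lt_succ_self Y))]
  | not φ ih =>
    obtain ⟨B, hB⟩ := ih
    exact ⟨B, fun v v' V V' h hV => not_congr (hB v v' V V' h hV)⟩
  | and φ ψ h₁ h₂ | or φ ψ h₁ h₂ | imp φ ψ h₁ h₂ =>
    obtain ⟨B, hB⟩ := h₁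
    obtain ⟨B', hB'⟩ := h₂
    refine ⟨max B B', fun v v' V V' h hV => ?_⟩
    simp only [ASat]
    rw [hB v v' V V' (fun x hx => h x (lt_max_of_lt_left hx))
      (fun x hx => hV x (lt_max_of_lt_left hx)),
      hB' v v' V V' (fun x hx => h x (lt_max_of_lt_right hx))
      (fun x hx => hV x (lt_max_of_lt_right hx))]
  | exN x φ ih =>
    obtain ⟨B, hB⟩ := ih
    refine ⟨B, fun v v' V V' h hV => exists_congr fun a => hB _ _ V V' (fun y hy => ?_) hV⟩
    simp only [Function.update_apply, h y hy]
  | allN x φ ih =>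
    obtain ⟨B, hB⟩ := ih
    refine ⟨B, fun v v' V V' h hV => forall_congr' fun a => hB _ _ V V' (fun y hy => ?_) hV⟩
    simp only [Function.update_apply, h y hy]
  | allS => exact ⟨0, fun _ _ _ _ _ _ => Iff.rfl⟩
  | exS => exact ⟨0, fun _ _ _ _ _ _ => Iff.rfl⟩

theorem exists_code_list (S : Set (Set N)) [IsACA S] (E : List (N × N × N × N)) :
    ∃ e : N, ∀ i, InF e (num i) ↔ i ∈ E := by
  induction E with
  | nil => exact ⟨emp, fun i => by simp [inF_emp S]⟩
  | cons j E ih =>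
    obtain ⟨e, he⟩ := ih
    refine ⟨ins e (num j), fun i => ?_⟩
    rw [inF_ins S, he, List.mem_cons, or_comm]
    refine or_congr ?_ Iff.rfl
    obtain ⟨a, b, c, d⟩ := i
    obtain ⟨a', b', c', d'⟩ := j
    simp [num]

/-- The sets given by the columns of the leftmost path contain witnesses for all true existential
statements about them. -/
theorem exists_column_of_aSat {H : N → Prop} {L : N → N} (hL : IsDef S L)
    (hpath : IsPath progCond H L)
    (hleft : ∀ F, IsDef S F → IsPath progCond H F → ∀ p, (∀ q, q < p → F q = L q) → L p ≤ F p)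
    {θ : Formula} (hθ : IsArithmetical θ) (X : ℕ) (v : ℕ → N) (c : ℕ → N) {A : Set N} (hA : A ∈ S)
    (h : ASat θ v (Function.update (fun Y => {z | L (pr z (c Y)) ≠ 0}) X A)) :
    ∃ c' : N, ASat θ v (Function.update (fun Y => {z | L (pr z (c Y)) ≠ 0}) X
      {z | L (pr z c') ≠ 0}) := by
  classical
  let O : N → N → N := fun c z => L (pr z c)
  obtain ⟨B, hB⟩ := exists_aSat_congr (N := N) θ
  obtain ⟨m, hm⟩ := exists_asg S v B
  have hA' := mem_iff_isDef.mp hA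
  obtain ⟨k, hk, E, hE, hG⟩ := compilesRel_formula (S := S) (O := O)
    (fun c => by simp only [O]; fun_prop) X c θ hθ 1 zero_lt_one
  obtain ⟨G, hGd, hG0, hGE⟩ := hG (fun _ z => if z ∈ A then 1 else 0) (by fun_prop)
  replace hGE := hGE G fun _ _ => rfl
  have hGA : {z | G 0 z ≠ 0} = A := by
    ext z
    simp [hG0 0 zero_lt_one]
  have hGm : G k m ≠ 0 := by
    refine (hE G hGE m).mpr ?_
    dsimp only
    rw [hGA, hB _ v _ _ hm fun _ _ => rfl]
    exact h
  -- the program for `θ`, with the assertion that `θ` is true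
  obtain ⟨e, he⟩ := exists_code_list S ((10, k, m, 0) :: E)
  have := holds_of_solution hL hpath hleft (e := e) hGd (fun i hi => by
    rcases List.mem_cons.mp ((he i).mp hi) with rfl | hi
    · intro m' d x₂ _
      simp only [Rel]
      simp
      rintro rfl
      exact hGm
    · exact hGE i hi)
  refine ⟨pr (acc e) 0, ?_⟩
  have h1 := hE (fun k m => L (pr m (pr (acc e) k)))
    (fun i hi => this i ((he i).mpr (by simp [hi]))) m
  have h2 := this _ ((he _).mpr (List.mem_cons_self ..)) m 0 _ rfl
  simp [Rel] at h2
  rw [← hB _ v _ _ hm fun _ _ => rfl]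
  exact h1.mp h2

end

/-! ### The chain of coded `β`-models -/

section
variable {N : Type u} [DOSemiring N] {S T : Set (Set N)}

/-- The collection of the columns of `W`. -/
def columns (W : Set N) : Set (Set N) := {A | ∃ i, A = {m | pr m i ∈ W}}

theorem columns_nonempty (W : Set N) : (columns W).Nonempty := ⟨_, 0, rfl⟩

theorem columns_subset [IsACA S] {W : Set N} (hW : W ∈ S) : columns W ⊆ S := by
  rintro _ ⟨i, rfl⟩
  have := mem_iff_isDef.mp hW
  exact setOf_mem (by fun_prop)

theorem sat_exS_iff (hS : S.Nonempty) {θ : Formula} (hθ : IsArithmetical θ) (X : ℕ) (v : ℕ → N)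
    (V : ℕ → Set N) :
    (toL2 S hS).Sat (.exS X θ) v V ↔ ∃ A ∈ S, ASat θ v (Function.update V X A) :=
  exists_congr fun _ => and_congr Iff.rfl (sat_iff_aSat S hS θ hθ _ _)

/-- `T` is the collection of sets of a `β`-submodel of the model with collection of sets `S`. -/
structure IsBeta (S T : Set (Set N)) : Prop where
  subset : T ⊆ S
  reflect : ∀ θ : Formula, IsArithmetical θ → ∀ (X : ℕ) (v : ℕ → N) (V : ℕ → Set N),
    (∀ k, V k ∈ T) → (∃ A ∈ S, ASat θ v (Function.update V X A)) →
    ∃ A ∈ T, ASat θ v (Function.update V X A)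

theorem IsBeta.sat_iff (h : IsBeta S T) (hS : S.Nonempty) (hT : T.Nonempty) {φ : Formula}
    (hφ : IsSigma11 φ) (v : ℕ → N) (V : ℕ → Set N) (hV : ∀ k, V k ∈ T) :
    (toL2 T hT).Sat φ v V ↔ (toL2 S hS).Sat φ v V := by
  obtain ⟨X, θ, hθ, rfl⟩ := hφ
  rw [sat_exS_iff hT hθ, sat_exS_iff hS hθ]
  refine ⟨?_, h.reflect θ hθ X v V hV⟩
  rintro ⟨A, hA, hA'⟩
  exact ⟨A, h.subset hA, hA'⟩

/-- A `β`-submodel satisfies arithmetical comprehension, since the existence of a set defined by an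
arithmetical formula is a `Σ¹₁` statement. -/
theorem IsBeta.isACA [IsACA S] (h : IsBeta S T) (hT : T.Nonempty) : IsACA T where
  nonempty := hT
  induction A hA := IsACA.induction A (h.subset hA)
  comprehension φ hφ x v V hV := by
    obtain ⟨B, hB⟩ := exists_aSat_congr (N := N) φ
    have hfresh : ∀ w A, ASat φ w (Function.update V B A) ↔ ASat φ w V := fun w A =>
      hB _ _ _ _ (fun _ _ => rfl) fun X hX => Function.update_of_ne hX.ne _ _
    have key : ∀ A : Set N, ASat (.allN x (.and (.imp (.mem (.var x) B) φ)
        (.imp φ (.mem (.var x) B)))) v (Function.update V B A) ↔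
        A = {a | ASat φ (Function.update v x a) V} := by
      intro A
      simp only [ASat, hfresh, tv_var, Function.update_self, Set.ext_iff, Set.mem_ofPred_eq,
        iff_iff_implies_and_implies]
    obtain ⟨A, hA, hA'⟩ := h.reflect _ (show IsArithmetical (.allN x (.and
      (.imp (.mem (.var x) B) φ) (.imp φ (.mem (.var x) B)))) from
        ⟨⟨True.intro, hφ⟩, hφ, True.intro⟩)
      B v V hV ⟨_, IsACA.comprehension φ hφ x v V fun k => h.subset (hV k), (key _).mpr rfl⟩
    rwa [← (key A).mp hA']

variable [IsACA S]

/-- The columns of the leftmost path form a `β`-model. -/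
theorem isBeta_columns {H : N → Prop} {L : N → N} (hL : IsDef S L)
    (hpath : IsPath progCond H L)
    (hleft : ∀ F, IsDef S F → IsPath progCond H F → ∀ p, (∀ q, q < p → F q = L q) → L p ≤ F p) :
    IsBeta S (columns {q | L q ≠ 0}) where
  subset := columns_subset (setOf_mem (by fun_prop))
  reflect θ hθ X v V hV := by
    rintro ⟨A, hA, h⟩
    choose c hc using hV
    obtain rfl : V = fun Y => {z | L (pr z (c Y)) ≠ 0} := funext hc
    obtain ⟨c', h'⟩ := exists_column_of_aSat hL hpath hleft hθ X v c hA h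
    exact ⟨_, ⟨c', rfl⟩, h'⟩

/-- The leftmost path of a tree is in every model of arithmetical comprehension that contains the
tree. -/
theorem leftmost_mem [IsACA T] (hTS : T ⊆ S) {J : N → Prop} {L : N → N} (hL : IsDef S L)
    (hJ : {y | J y} ∈ T) (h : IsLeftmost J L) : {q | L q ≠ 0} ∈ T := by
  have hJ' : IsDef T J := mem_iff_isDef.mp hJ
  obtain ⟨L', hL', h'⟩ := exists_isLeftmost (S := T) (Γ := N) (J := fun p : N × N => J p.2)
    (by fun_prop)
  have h0 : IsDef T fun t => L' (0, t) := by fun_prop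
  rw [IsLeftmost.unique (S := S) hL (hTS h0) h (h' 0)]
  exact setOf_mem (by fun_prop)

/-- The leftmost paths of the levels of the jump hierarchy form a chain of `β`-models: the path of
level `j` is arithmetical in the tree of level `j + 1`, which is a set of the next model. -/
theorem exists_beta_chain (hS : S.Nonempty) (hdet : AllSigma01DiffDet (toL2 S hS)) {A : Set N}
    (hA : A ∈ S) (n : N) : ∃ L : N × N → N, IsDef S L ∧
      (∀ j ≤ n, IsBeta S (columns {q | L (j, q) ≠ 0})) ∧ A ∈ columns {q | L (0, q) ≠ 0} ∧
      ∀ j < n, {q | L (j, q) ≠ 0} ∈ columns {q | L (j + 1, q) ≠ 0} := by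
  obtain ⟨H, hH, h0, hsucc⟩ := exists_jump_hierarchy hS hdet hA (isDef_progCond (S := S)) n
  obtain ⟨L, hL, hleft⟩ := exists_isLeftmost (S := S) (J := fun p : N × N => H (p.1 + 1, p.2))
    (by fun_prop)
  have spec : ∀ j ≤ n, _ := fun j hj => (hleft j).spec (S := S) (C := progCond)
    (H := fun z => H (j, z)) (L := fun t => L (j, t)) (by fun_prop) (by fun_prop)
    (hsucc j hj) (exists_isPath (by fun_prop))
  have hLj : ∀ j, IsDef S fun t => L (j, t) := fun j => by fun_prop
  have beta : ∀ j ≤ n, IsBeta S (columns {q | L (j, q) ≠ 0}) := fun j hj =>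
    isBeta_columns (hLj j) (spec j hj).1 (spec j hj).2
  have col : ∀ j ≤ n, {z | H (j, z)} ∈ columns {q | L (j, q) ≠ 0} := fun j hj =>
    ⟨0, Set.ext fun z => ((spec j hj).1.col z).symm⟩
  refine ⟨L, hL, beta, ?_, fun j hj => ?_⟩
  · convert col 0 zero_le using 1
    exact Set.ext fun z => (h0 z).symm
  · have hj' : j + 1 ≤ n := succ_le_iff'.mpr hj
    have := (beta _ hj').isACA (columns_nonempty _)
    exact leftmost_mem (beta _ hj').subset (hLj j) (col _ hj') (hleft j)

end

theorem ACA0.isACA {N : Type u} [DOSemiring N] {S : Set (Set N)} {hS : S.Nonempty}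
    (h : ACA0 (toL2 S hS)) : IsACA S where
  nonempty := hS
  comprehension φ hφ x v V hV := by
    obtain ⟨A, hA, hA'⟩ := h.comprehension φ hφ x v V hV
    convert hA using 1
    ext a
    rw [hA' a]
    exact (sat_iff_aSat S hS φ hφ _ _).symm
  induction A hA h0 hs a := by
    have := h.rca0.induction (.exN 1 (.mem (.var 0) 0)) ⟨1, _, .mem _ _, rfl⟩ 0 (fun _ => (0 : N))
      (fun _ => A) (fun _ => hA)
    have key : ∀ a : N, (toL2 S hS).Sat (.exN 1 (.mem (.var 0) 0))
        (Function.update (fun _ => (0 : N)) 0 a) (fun _ => A) ↔ a ∈ A := by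
      intro a
      rw [sat_iff_aSat S hS _ (by trivial)]
      simp [ASat]
    exact (key a).mp (this ((key _).mpr h0) (fun a ha => (key _).mpr (hs a ((key a).mp ha))) a)

/-- The theorem for structures whose first-order part is a `DOSemiring`. -/
theorem pi11CA0'_of_det {N : Type u} [DOSemiring N] {S : Set (Set N)} {hS : S.Nonempty}
    (hACA : ACA0 (toL2 S hS)) (hdet : AllSigma01DiffDet (toL2 S hS)) : Pi11CA0' (toL2 S hS) where
  rca0 := hACA.rca0
  chain n X hX := by
    have := hACA.isACA
    obtain ⟨L, hL, hbeta, hbase, hmem⟩ := exists_beta_chain hS hdet hX n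
    have hZ : {x | ∃ j q, x = pr q j ∧ L (j, q) ≠ 0} ∈ S := setOf_mem (by fun_prop)
    have hcol : ∀ j,
        {q | pr q j ∈ {x | ∃ j q, x = pr q j ∧ L (j, q) ≠ 0}} = {q | L (j, q) ≠ 0} := by
      intro j
      ext q
      constructor
      · rintro ⟨j', q', h, hq⟩
        obtain ⟨rfl, rfl⟩ := pr_inj h
        exact hq
      · exact fun hq => ⟨j, q, rfl, hq⟩
    have hsub : ∀ j < n, columns {q | L (j, q) ≠ 0} ⊆ columns {q | L (j + 1, q) ≠ 0} := by
      intro j hj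
      have := (hbeta _ (succ_le_iff'.mpr hj)).isACA (columns_nonempty _)
      exact columns_subset (hmem j hj)
    refine ⟨_, hZ, ⟨fun j hj => ?_, ?_, fun j hj => ?_, fun j hj => ?_⟩⟩
    · intro φ hφ v V hV
      have := hbeta j (le_iff_lt_or_eq.mpr hj)
      rw [← hcol j] at this
      exact this.sat_iff hS (columns_nonempty _) hφ v V hV
    · rw [← hcol 0] at hbase
      exact hbase
    · have := hmem j hj
      rw [← hcol j, ← hcol (j + 1)] at this
      exact this
    · have h1 := hsub j hj
      have h2 := hbeta j hj.le
      have h3 := hbeta _ (succ_le_iff'.mpr hj)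
      rw [← hcol j] at h1 h2
      rw [← hcol (j + 1)] at h1 h3
      refine ⟨h1, fun φ hφ v V hV => ?_⟩
      exact (h2.sat_iff hS (columns_nonempty _) hφ v V hV).trans
        (h3.sat_iff hS (columns_nonempty _) hφ v V fun k => h1 (hV k)).symm

end SOA

theorem mainTheorem5 (M : SOA.L2Structure.{u}) (hACA : SOA.ACA0 M)
    (hDet : SOA.AllSigma01DiffDet M) : SOA.Pi11CA0' M := by
  obtain ⟨N, arith, S, hS⟩ := M
  let _ := hACA.rca0.semiring.toDOSemiring
  exact SOA.pi11CA0'_of_det (N := N) (S := S) (hS := hS) hACA hDet
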